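/- **Algorithm.** Let $G$ be a simple $d$-regular graph with $n$ nodes, $d\ge 3$, and put $r_G=\lceil 2\log_{d-1}\log n\rceil$ and $\gamma'_G=\sqrt{\log_d n/r_G}$ ($\log$ without a base is the natural logarithm). For an integer $l$, the algorithm $\mathcal A'(G,l)$ allocates $n$ balls one after another to the nodes of $G$, which are empty at the start. Each ball picks a node $u_0$ of $G$ uniformly at random and takes a non-backtracking random walk $(u_0,u_1,\dots,u_{l r_G})$ of length $l\cdot r_G$ from it: every step goes to a uniformly random neighbour of the current node, except that the walk never traverses the same edge twice in a row. The ball is then placed on a least-loaded node of its set of potential choices $\{u_{j r_G} : 0\le j\le l\}$, ties being broken uniformly at random. The random choices of different balls are independent. Let $m^*$ be the maximum load, that is, the largest number of balls on a node at the end. **Theorem.** For every constant $K$ there are constants $C>0$ and $c>0$ such that for every function $\omega$ with $\omega(n)\to\infty$ the following holds for all sufficiently large $n$. Let $G$ be a $d$-regular graph with $n$ nodes, where $3\le d\le K\log n$, and let $l\ge 0$ be an integer such that $G$ has girth at least $10\,l\,(\log\log n)^2$. I. If $\omega(n)\le l\le 4\gamma'_G$, then with probability at least $1-n^{-c}$,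 $$m^*\le C\cdot\frac{\log_d n\cdot\log\log n}{r_G\,l^2}.$$ II. If $l\ge 4\gamma'_G$, then with probability at least $1-n^{-c}$, $$m^*\le C\cdot\frac{\log\log n}{\log(l/\gamma'_G)}.$$ -/

import Mathlib

open Filter

noncomputable section

/-- Uniform choice from a finite set `S` (and the point `a` when `S` is empty). -/
def uniformOr {V : Type*} (S : Finset V) (a : V) : PMF V :=
  open Classical in if h : S.Nonempty then PMF.uniformOfFinset S h else PMF.pure a

open Classical in
/-- The nodes to which a non-backtracking walker at `cur` may move: the neighbours of `cur`,
except the node `prev` from which it has just arrived (`prev = none` before the first step). -/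
def nbNext {V : Type*} [Fintype V] (G : SimpleGraph V) (prev : Option V) (cur : V) : Finset V :=
  Finset.univ.filter fun w => G.Adj cur w ∧ prev ≠ some w

/-- The non-backtracking random walk with `L` steps from `cur`, having just come from `prev`:
the law of the list `[u₀, u₁, …, u_L]` of visited nodes, `u₀ = cur`. -/
def nbWalkAux {V : Type*} [Fintype V] (G : SimpleGraph V) : ℕ → Option V → V → PMF (List V)
  | 0, _, cur => PMF.pure [cur]
  | L + 1, prev, cur =>
      (uniformOr (nbNext G prev cur) cur).bind fun w =>
        (nbWalkAux G L (some cur) w).map fun p => cur :: p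

/-- The non-backtracking random walk of length `L` from `u`. -/
def nbWalk {V : Type*} [Fintype V] (G : SimpleGraph V) (L : ℕ) (u : V) : PMF (List V) :=
  nbWalkAux G L none u

open Classical in
/-- The potential choices `{u_{j r} | 0 ≤ j ≤ l}` on the walk `p = [u₀, u₁, …]`. -/
def potentialChoices {V : Type*} [Fintype V] (l r : ℕ) (p : List V) : Finset V :=
  Finset.univ.filter fun v => ∃ j ≤ l, p[j * r]? = some v

open Classical in
/-- The nodes of `S` whose load under `x` is minimal. -/
def leastLoaded {V : Type*} (x : V → ℕ) (S : Finset V) : Finset V :=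
  S.filter fun v => ∀ u ∈ S, x v ≤ x u

open Classical in
/-- One round: from the loads `x`, a ball picks a uniform node `u`, takes a non-backtracking
random walk of length `l * r` from it, and is placed on a least-loaded potential choice, ties
being broken uniformly at random. The result is the law of the new loads. -/
def allocateBall {V : Type*} [Fintype V] [Nonempty V] (G : SimpleGraph V) (l r : ℕ)
    (x : V → ℕ) : PMF (V → ℕ) :=
  (PMF.uniformOfFintype V).bind fun u =>
    (nbWalk G (l * r) u).bind fun p =>
      (uniformOr (leastLoaded x (potentialChoices l r p)) u).map fun v =>
        Function.update x v (x v + 1)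

/-- The law of the loads after `t` sequential balls, starting from empty nodes. -/
def loads {V : Type*} [Fintype V] [Nonempty V] (G : SimpleGraph V) (l r : ℕ) :
    ℕ → PMF (V → ℕ)
  | 0 => PMF.pure fun _ => 0
  | t + 1 => (loads G l r t).bind (allocateBall G l r)

/-- The maximum load. -/
def maxLoad {V : Type*} [Fintype V] (x : V → ℕ) : ℕ := Finset.univ.sup x

/-- `r_G = ⌈2 log_{d-1} log n⌉`. -/
def stride (n d : ℕ) : ℕ := ⌈2 * Real.logb ((d : ℝ) - 1) (Real.log n)⌉₊

/-- The law of the loads after `n` balls are allocated by `𝒜'(G, l)` on the `d`-regular graph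
`G` with `n` nodes. -/
def sparseLoads {V : Type*} [Fintype V] [Nonempty V] (G : SimpleGraph V) (d l : ℕ) :
    PMF (V → ℕ) :=
  loads G l (stride (Fintype.card V) d) (Fintype.card V)

/-- `γ'_G = √(log_d n / r_G)`. -/
def gammaG (n d : ℕ) : ℝ := Real.sqrt (Real.logb d n / stride n d)

/-- The probability that the maximum load attained by `𝒜'(G, l)` is at most `b`. -/
def probMaxLoadLE {V : Type*} [Fintype V] [Nonempty V] (G : SimpleGraph V) (d l : ℕ) (b : ℝ) :
    ℝ :=
  ((sparseLoads G d l).toOuterMeasure {x | (maxLoad x : ℝ) ≤ b}).toReal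

end

open scoped ENNReal NNReal

/-! ### Expectation and probability under a `PMF` -/

/-- The expectation of a nonnegative function under a probability mass function. -/
noncomputable def PMF.expect {α : Type*} (p : PMF α) (f : α → ℝ≥0∞) : ℝ≥0∞ := ∑' a, p a * f a

namespace PMF

variable {α β : Type*}

theorem expect_pure (a : α) (f : α → ℝ≥0∞) : (PMF.pure a).expect f = f a := by
  unfold expect
  rw [tsum_eq_single a]
  · simp
  · intro b hb; simp [PMF.pure_apply, hb]

theorem expect_bind (p : PMF α) (q : α → PMF β) (f : β → ℝ≥0∞) :
    (p.bind q).expect f = p.expect fun a => (q a).expect f := by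
  unfold expect
  simp only [PMF.bind_apply, ← ENNReal.tsum_mul_right, ← ENNReal.tsum_mul_left]
  rw [ENNReal.tsum_comm]
  simp only [mul_assoc]

theorem expect_map (p : PMF α) (g : α → β) (f : β → ℝ≥0∞) :
    (p.map g).expect f = p.expect fun a => f (g a) := by
  rw [← PMF.bind_pure_comp, expect_bind]
  simp [expect_pure]

theorem expect_mono_support (p : PMF α) {f g : α → ℝ≥0∞} (h : ∀ a ∈ p.support, f a ≤ g a) :
    p.expect f ≤ p.expect g := by
  refine ENNReal.tsum_le_tsum fun a => ?_
  by_cases ha : p a = 0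
  · simp [ha]
  · gcongr; exact h a ha

theorem expect_mono (p : PMF α) {f g : α → ℝ≥0∞} (h : ∀ a, f a ≤ g a) :
    p.expect f ≤ p.expect g := p.expect_mono_support fun a _ => h a

theorem expect_congr_support (p : PMF α) {f g : α → ℝ≥0∞} (h : ∀ a ∈ p.support, f a = g a) :
    p.expect f = p.expect g :=
  le_antisymm (p.expect_mono_support fun a ha => (h a ha).le)
    (p.expect_mono_support fun a ha => (h a ha).ge)

theorem expect_const (p : PMF α) (c : ℝ≥0∞) : (p.expect fun _ => c) = c := by
  simp [expect, ENNReal.tsum_mul_right, p.tsum_coe]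

theorem expect_mul_left (p : PMF α) (c : ℝ≥0∞) (f : α → ℝ≥0∞) :
    (p.expect fun a => c * f a) = c * p.expect f := by
  simp only [expect, ← ENNReal.tsum_mul_left]
  exact tsum_congr fun a => by ring

theorem expect_mul_right (p : PMF α) (c : ℝ≥0∞) (f : α → ℝ≥0∞) :
    (p.expect fun a => f a * c) = p.expect f * c := by
  simp only [expect, ← ENNReal.tsum_mul_right]
  exact tsum_congr fun a => by ring

theorem expect_add (p : PMF α) (f g : α → ℝ≥0∞) :
    (p.expect fun a => f a + g a) = p.expect f + p.expect g := by
  simp only [expect, mul_add, ENNReal.tsum_add]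

theorem expect_finset_sum {ι : Type*} (s : Finset ι) (p : PMF α) (f : ι → α → ℝ≥0∞) :
    (p.expect fun a => ∑ i ∈ s, f i a) = ∑ i ∈ s, p.expect (f i) := by
  simp only [expect, Finset.mul_sum]
  exact Summable.tsum_finsetSum fun i _ => ENNReal.summable

theorem mul_le_expect (p : PMF α) (f : α → ℝ≥0∞) (a : α) : p a * f a ≤ p.expect f :=
  ENNReal.le_tsum (f := fun a => p a * f a) a

open Classical in
/-- The probability of an event. -/
noncomputable def prob (p : PMF α) (s : α → Prop) : ℝ≥0∞ := p.expect fun a => if s a then 1 else 0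

theorem prob_eq_toOuterMeasure (p : PMF α) (s : α → Prop) :
    p.prob s = p.toOuterMeasure {a | s a} := by
  classical
  rw [prob, expect, PMF.toOuterMeasure_apply]
  refine tsum_congr fun a => ?_
  by_cases h : s a <;> simp [Set.indicator, h]

theorem prob_mono_support (p : PMF α) {s t : α → Prop} (h : ∀ a ∈ p.support, s a → t a) :
    p.prob s ≤ p.prob t := by
  classical
  refine p.expect_mono_support fun a ha => ?_
  by_cases hs : s a
  · simp [hs, h a ha hs]
  · simp [hs]

theorem prob_le_one (p : PMF α) (s : α → Prop) : p.prob s ≤ 1 := by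
  classical
  calc p.prob s ≤ p.expect fun _ => 1 := p.expect_mono fun a => by split_ifs <;> simp
    _ = 1 := p.expect_const 1

theorem prob_add_prob_not (p : PMF α) (s : α → Prop) :
    p.prob s + p.prob (fun a => ¬ s a) = 1 := by
  classical
  rw [prob, prob, ← expect_add]
  refine Eq.trans ?_ (p.expect_const 1)
  congr 1; funext a
  by_cases h : s a <;> simp [h]

theorem prob_bind (p : PMF α) (q : α → PMF β) (s : β → Prop) :
    (p.bind q).prob s = p.expect fun a => (q a).prob s := expect_bind _ _ _

end PMF

theorem uniformOr_apply {V : Type*} {S : Finset V} (h : S.Nonempty) (a v : V) :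
    uniformOr S a v = open Classical in if v ∈ S then (S.card : ℝ≥0∞)⁻¹ else 0 := by
  classical
  rw [uniformOr, dif_pos h, PMF.uniformOfFinset_apply]

theorem uniformOr_support {V : Type*} {S : Finset V} (h : S.Nonempty) (a : V) :
    (uniformOr S a).support = S := by
  rw [uniformOr, dif_pos h, PMF.support_uniformOfFinset]

/-! ### Non-backtracking lists -/

/-- Lists of nodes that traverse edges and never the same edge twice in a row. -/
structure SimpleGraph.IsNonBacktracking {V : Type*} (G : SimpleGraph V) (p : List V) : Prop where
  adj : ∀ i a b, p[i]? = some a → p[i + 1]? = some b → G.Adj a b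
  ne : ∀ i a b, p[i]? = some a → p[i + 2]? = some b → a ≠ b

namespace SimpleGraph.IsNonBacktracking

variable {V : Type*} {G : SimpleGraph V} {p : List V}

theorem drop (hp : G.IsNonBacktracking p) (n : ℕ) : G.IsNonBacktracking (p.drop n) := by
  constructor
  · intro i a b ha hb
    rw [List.getElem?_drop] at ha hb
    exact hp.adj _ a b ha hb
  · intro i a b ha hb
    rw [List.getElem?_drop] at ha hb
    exact hp.ne _ a b ha hb

theorem take (hp : G.IsNonBacktracking p) (n : ℕ) : G.IsNonBacktracking (p.take n) := by
  constructor
  · intro i a b ha hb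
    rw [List.getElem?_take] at ha hb
    split_ifs at ha hb
    exact hp.adj _ a b ha hb
  · intro i a b ha hb
    rw [List.getElem?_take] at ha hb
    split_ifs at ha hb
    exact hp.ne _ a b ha hb

theorem reverse (hp : G.IsNonBacktracking p) : G.IsNonBacktracking p.reverse := by
  constructor
  · intro i a b ha hb
    have hi := (List.getElem?_eq_some_iff.mp ha).1
    have hi' := (List.getElem?_eq_some_iff.mp hb).1
    rw [List.length_reverse] at hi hi'
    rw [List.getElem?_reverse hi] at ha
    rw [List.getElem?_reverse hi'] at hb
    refine (hp.adj (p.length - 1 - (i + 1)) b a hb ?_).symm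
    rw [← ha]; congr 1; omega
  · intro i a b ha hb
    have hi := (List.getElem?_eq_some_iff.mp ha).1
    have hi' := (List.getElem?_eq_some_iff.mp hb).1
    rw [List.length_reverse] at hi hi'
    rw [List.getElem?_reverse hi] at ha
    rw [List.getElem?_reverse hi'] at hb
    refine (hp.ne (p.length - 1 - (i + 2)) b a hb ?_).symm
    rw [← ha]; congr 1; omega

theorem cons_cons {a b : V} {t : List V} (hp : G.IsNonBacktracking (b :: t)) (hab : G.Adj a b)
    (ht : t[0]? ≠ some a) : G.IsNonBacktracking (a :: b :: t) := by
  constructor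
  · intro i x y hx hy
    cases i with
    | zero =>
      simp at hx hy
      subst hx hy; exact hab
    | succ i => exact hp.adj i x y (by simpa using hx) (by simpa using hy)
  · intro i x y hx hy
    cases i with
    | zero =>
      simp only [List.getElem?_cons_zero, Option.some.injEq] at hx
      simp only [zero_add, List.getElem?_cons_succ] at hy
      rintro rfl
      subst hx
      exact ht hy
    | succ i => exact hp.ne i x y (by simpa using hx) (by simpa using hy)

theorem isChain (hp : G.IsNonBacktracking p) : p.IsChain G.Adj := by
  rw [List.isChain_iff_getElem]
  intro i hi
  exact hp.adj i _ _ (by simp) (by simp)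

end SimpleGraph.IsNonBacktracking

theorem PMF.map_apply_of_injective {α β : Type*} (p : PMF α) {f : α → β}
    (hf : Function.Injective f) (a : α) : p.map f (f a) = p a := by
  classical
  rw [PMF.map_apply, tsum_eq_single a]
  · simp
  · intro b hb
    rw [if_neg]
    exact fun h => hb (hf h).symm

/-! ### Probabilities of single non-backtracking walks -/

section Walk

variable {V : Type*} [Fintype V] {G : SimpleGraph V}

theorem mem_nbNext {prev : Option V} {cur w : V} :
    w ∈ nbNext G prev cur ↔ G.Adj cur w ∧ prev ≠ some w := by
  simp [nbNext]

variable [DecidableRel G.Adj] {d : ℕ}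

theorem card_nbNext_le (hG : G.IsRegularOfDegree d) (prev : Option V) (cur : V) :
    (nbNext G prev cur).card ≤ d := by
  rw [← hG cur, ← SimpleGraph.card_neighborFinset_eq_degree]
  refine Finset.card_le_card fun w hw => ?_
  simpa using (mem_nbNext.mp hw).1

theorem le_card_nbNext (hG : G.IsRegularOfDegree d) (prev : Option V) (cur : V) :
    d - 1 ≤ (nbNext G prev cur).card := by
  classical
  rw [← hG cur, ← SimpleGraph.card_neighborFinset_eq_degree]
  cases prev with
  | none =>
    refine (Nat.sub_le _ _).trans (Finset.card_le_card fun w hw => ?_)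
    simpa [mem_nbNext] using hw
  | some a =>
    refine Finset.pred_card_le_card_erase.trans (Finset.card_le_card (s := Finset.erase _ a) fun w hw => ?_)
    rw [Finset.mem_erase] at hw
    simp only [mem_nbNext, ne_eq, Option.some.injEq]
    exact ⟨by simpa using hw.2, fun h => hw.1 h.symm⟩

theorem card_nbNext_some (hG : G.IsRegularOfDegree d) {a cur : V} (h : G.Adj cur a) :
    (nbNext G (some a) cur).card ≤ d - 1 := by
  classical
  rw [← hG cur, ← SimpleGraph.card_neighborFinset_eq_degree, ← Finset.card_erase_of_mem (a := a)]
  · refine Finset.card_le_card fun w hw => ?_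
    have := mem_nbNext.mp hw
    simp only [ne_eq, Option.some.injEq] at this
    rw [Finset.mem_erase]
    exact ⟨fun h => this.2 h.symm, by simpa using this.1⟩
  · simpa using h

theorem nbNext_nonempty (hd : 3 ≤ d) (hG : G.IsRegularOfDegree d) (prev : Option V) (cur : V) :
    (nbNext G prev cur).Nonempty := by
  have := le_card_nbNext hG prev cur
  exact Finset.card_pos.mp (by omega)

omit [DecidableRel G.Adj] in
theorem nbWalkAux_getElem?_zero (L : ℕ) (prev : Option V) (cur : V) {p : List V}
    (hp : p ∈ (nbWalkAux G L prev cur).support) : p[0]? = some cur := by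
  cases L with
  | zero => simp [nbWalkAux] at hp; simp [hp]
  | succ L =>
    simp only [nbWalkAux, PMF.mem_support_bind_iff, PMF.mem_support_map_iff] at hp
    obtain ⟨w, -, t, -, rfl⟩ := hp
    simp

/-- The last conjunct carries the induction: it is what forbids backtracking when a node is put in
front. -/
theorem nbWalkAux_support (hd : 3 ≤ d) (hG : G.IsRegularOfDegree d) (L : ℕ) (prev : Option V)
    (cur : V) {p : List V} (hp : p ∈ (nbWalkAux G L prev cur).support) :
    p.length = L + 1 ∧ G.IsNonBacktracking p ∧ ∀ w, p[1]? = some w → prev ≠ some w := by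
  induction L generalizing prev cur p with
  | zero =>
    simp [nbWalkAux] at hp
    subst hp
    refine ⟨rfl, ⟨?_, ?_⟩, ?_⟩ <;> simp
  | succ L ih =>
    simp only [nbWalkAux, PMF.mem_support_bind_iff, PMF.mem_support_map_iff] at hp
    obtain ⟨w, hw, t, ht, rfl⟩ := hp
    rw [uniformOr_support (nbNext_nonempty hd hG prev cur), Finset.mem_coe, mem_nbNext] at hw
    obtain ⟨h1, h2, h3⟩ := ih _ _ ht
    have h0 := nbWalkAux_getElem?_zero _ _ _ ht
    cases t with
    | nil => simp at h0
    | cons b t =>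
      simp only [List.getElem?_cons_zero, Option.some.injEq] at h0
      subst h0
      refine ⟨by simp [h1], h2.cons_cons hw.1 fun h => h3 cur ?_ rfl, ?_⟩
      · simpa using h
      · intro x hx
        simp at hx
        subst hx
        exact hw.2

omit [DecidableRel G.Adj] in
theorem nbWalkAux_succ_apply (L : ℕ) (prev : Option V) (cur w : V) (t : List V) :
    nbWalkAux G (L + 1) prev cur (cur :: w :: t) =
      uniformOr (nbNext G prev cur) cur w * nbWalkAux G L (some cur) w (w :: t) := by
  rw [nbWalkAux, PMF.bind_apply, tsum_eq_single w]
  · rw [PMF.map_apply_of_injective _ (List.cons_injective)]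
  · intro x hx
    rw [PMF.map_apply_of_injective _ (List.cons_injective), mul_eq_zero]
    right
    rw [PMF.apply_eq_zero_iff]
    intro h
    have := nbWalkAux_getElem?_zero _ _ _ h
    simp at this
    exact hx this.symm

theorem uniformOr_nbNext_le (hd : 3 ≤ d) (hG : G.IsRegularOfDegree d) (prev : Option V)
    (cur w : V) : uniformOr (nbNext G prev cur) cur w ≤ ((d - 1 : ℕ) : ℝ≥0∞)⁻¹ := by
  rw [uniformOr_apply (nbNext_nonempty hd hG prev cur)]
  split_ifs
  · rw [ENNReal.inv_le_inv]
    exact_mod_cast le_card_nbNext hG prev cur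
  · simp

theorem nbWalkAux_apply_le (hd : 3 ≤ d) (hG : G.IsRegularOfDegree d) (L : ℕ) (prev : Option V)
    (cur : V) (p : List V) : nbWalkAux G L prev cur p ≤ (((d - 1 : ℕ) : ℝ≥0∞)⁻¹) ^ L := by
  induction L generalizing prev cur p with
  | zero => simpa using PMF.coe_le_one _ _
  | succ L ih =>
    by_cases hp : p ∈ (nbWalkAux G (L + 1) prev cur).support
    · have h1 := (nbWalkAux_support hd hG _ _ _ hp).1
      have h0 := nbWalkAux_getElem?_zero _ _ _ hp
      match p, h1, h0 with
      | a :: w :: t, h1, h0 =>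
        simp only [List.getElem?_cons_zero, Option.some.injEq] at h0
        subst h0
        rw [nbWalkAux_succ_apply, pow_succ']
        exact mul_le_mul' (uniformOr_nbNext_le hd hG _ _ _) (ih _ _ _)
    · rw [(PMF.apply_eq_zero_iff _ _).mpr hp]; simp

/-- Arriving from a true neighbour excludes one node at each step, so there are at most `d - 1`
options throughout. -/
theorem le_nbWalkAux_apply (hd : 3 ≤ d) (hG : G.IsRegularOfDegree d) (L : ℕ) {a cur : V}
    (hac : G.Adj cur a) {p : List V} (hp : G.IsNonBacktracking p) (hL : p.length = L + 1)
    (h0 : p[0]? = some cur) (h1 : p[1]? ≠ some a) :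
    (((d - 1 : ℕ) : ℝ≥0∞)⁻¹) ^ L ≤ nbWalkAux G L (some a) cur p := by
  induction L generalizing a cur p with
  | zero =>
    match p, hL with
    | [b], _ =>
      simp at h0
      subst h0
      simp [nbWalkAux]
  | succ L ih =>
    match p, hL, h0 with
    | b :: w :: t, hL, h0 =>
      simp only [List.getElem?_cons_zero, Option.some.injEq] at h0
      subst h0
      have hbw : G.Adj b w := hp.adj 0 b w (by simp) (by simp)
      rw [nbWalkAux_succ_apply, pow_succ']
      refine mul_le_mul' ?_ (ih hbw.symm (p := w :: t) ?_ (by simpa using hL) (by simp) ?_)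
      · rw [uniformOr_apply (nbNext_nonempty hd hG _ _), if_pos]
        · rw [ENNReal.inv_le_inv]
          exact_mod_cast card_nbNext_some hG hac
        · rw [mem_nbNext]
          refine ⟨hbw, ?_⟩
          simpa [eq_comm] using h1
      · simpa using hp.drop 1
      · intro h
        exact hp.ne 0 b b (by simp) (by simpa using h) rfl

/-- Only the first step has `d` options instead of `d - 1`, and `d / (d - 1) ≤ 3 / 2` for `d ≥ 3`.
Up to this factor the walk is uniform on non-backtracking paths, hence reversible. -/
theorem le_nbWalk_apply (hd : 3 ≤ d) (hG : G.IsRegularOfDegree d) (L : ℕ) {cur : V}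
    {p : List V} (hp : G.IsNonBacktracking p) (hL : p.length = L + 1) (h0 : p[0]? = some cur) :
    (((d - 1 : ℕ) : ℝ≥0∞)⁻¹) ^ L ≤ 3 / 2 * nbWalk G L cur p := by
  unfold nbWalk
  have h32 : (1 : ℝ≥0∞) ≤ 3 / 2 := by
    rw [ENNReal.le_div_iff_mul_le (by simp) (by simp)]; norm_num
  cases L with
  | zero =>
    match p, hL with
    | [b], _ =>
      simp at h0
      subst h0
      simpa [nbWalkAux] using h32
  | succ L =>
    match p, hL, h0 with
    | b :: w :: t, hL, h0 =>
      simp only [List.getElem?_cons_zero, Option.some.injEq] at h0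
      subst h0
      have hbw : G.Adj b w := hp.adj 0 b w (by simp) (by simp)
      rw [nbWalkAux_succ_apply, pow_succ', ← mul_assoc]
      refine mul_le_mul' ?_ (le_nbWalkAux_apply hd hG L hbw.symm (p := w :: t) ?_
        (by simpa using hL) (by simp) ?_)
      · rw [uniformOr_apply (nbNext_nonempty hd hG _ _), if_pos (by rw [mem_nbNext]; simp [hbw])]
        have h1 : ((nbNext G none b).card : ℝ≥0∞) ≤ 3 / 2 * ((d - 1 : ℕ) : ℝ≥0∞) := by
          have h2 : (((nbNext G none b).card * 2 : ℕ) : ℝ≥0∞) ≤ ((3 * (d - 1) : ℕ) : ℝ≥0∞) := by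
            have := card_nbNext_le hG none b
            exact_mod_cast (by omega : (nbNext G none b).card * 2 ≤ 3 * (d - 1))
          rw [← ENNReal.mul_div_right_comm, ENNReal.le_div_iff_mul_le (by simp) (by simp)]
          exact_mod_cast h2
        have hq : ((d - 1 : ℕ) : ℝ≥0∞) ≠ 0 := by
          simp only [ne_eq, Nat.cast_eq_zero]; omega
        have hc : ((nbNext G none b).card : ℝ≥0∞) ≠ 0 := by
          have := nbNext_nonempty hd hG none b
          simpa using this.ne_empty
        rw [← div_eq_mul_inv, ENNReal.le_div_iff_mul_le (by simp [hc]) (by simp), mul_comm,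
          ← div_eq_mul_inv, ENNReal.div_le_iff hq (by simp)]
        exact h1
      · simpa using hp.drop 1
      · intro h
        exact hp.ne 0 b b (by simp) (by simpa using h) rfl

end Walk

/-! ### Consequences of large girth -/

namespace SimpleGraph.IsNonBacktracking

variable {V : Type*} {G : SimpleGraph V}

theorem exists_cycle_of_closed {v : V} {t : List V} (hp : G.IsNonBacktracking (v :: t))
    (ht : t.Nodup) (hne : t ≠ []) (hv : t.getLast hne = v) :
    ∃ w : G.Walk v v, w.IsCycle ∧ w.length = t.length := by
  have hc := hp.isChain
  have hct : t.IsChain G.Adj := hc.of_cons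
  obtain ⟨x, s, rfl⟩ := List.exists_cons_of_ne_nil hne
  have hvx : G.Adj v x := hp.adj 0 v x (by simp) (by simp)
  obtain ⟨w, hw⟩ : ∃ w : G.Walk x v, w.support = x :: s := by
    subst hv
    exact ⟨SimpleGraph.Walk.ofSupport (x :: s) hne hct, SimpleGraph.Walk.support_ofSupport hne hct⟩
  have hwl : w.length = s.length := by
    have := w.length_support
    rw [hw] at this
    simpa using this.symm
  refine ⟨.cons hvx w, ?_, by simp [hwl]⟩
  rw [SimpleGraph.Walk.isCycle_iff_isPath_tail_and_le_length]
  refine ⟨?_, ?_⟩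
  · rw [SimpleGraph.Walk.isPath_def, SimpleGraph.Walk.support_tail_of_not_nil _ (by simp)]
    simpa [hw] using ht
  · rw [SimpleGraph.Walk.length_cons, hwl]
    clear hwl hw w ht hct hc
    match s, hne, hv, hp with
    | [], _, hv, _ => simp at hv; subst hv; exact absurd hvx (G.irrefl)
    | [y], _, hv, hp =>
      simp at hv
      subst hv
      exact absurd rfl (hp.ne 0 y y (by simp) (by simp))
    | _ :: _ :: _, _, _, _ => simp

/-- A closest repetition closes up a cycle of fewer than `p.length` edges. An acyclic graph has
`girth` equal to `0`, so there the hypothesis leaves only the empty list. -/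
theorem nodup {p : List V} (hp : G.IsNonBacktracking p) (hg : p.length ≤ G.girth) : p.Nodup := by
  classical
  by_contra hnd
  -- The minimal gap `k` between equal entries makes the `k` entries that close the cycle pairwise
  -- distinct.
  have hex : ∃ k, 0 < k ∧ ∃ i, i + k < p.length ∧ p[i]? = p[i + k]? := by
    rw [List.nodup_iff_getElem?_ne_getElem?] at hnd
    push Not at hnd
    obtain ⟨i, j, hij, hj, h⟩ := hnd
    exact ⟨j - i, by omega, i, by omega, by rw [h]; congr 1; omega⟩
  obtain ⟨hk0, i, hi, hik⟩ := Nat.find_spec hex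
  have hmin := fun m => Nat.find_min hex (m := m)
  set k := Nat.find hex
  have hdrop : p.drop i = p[i] :: p.drop (i + 1) := List.drop_eq_getElem_cons (by omega)
  set t := (p.drop (i + 1)).take k with ht
  have htl : t.length = k := by simp [ht]; omega
  have hnb : G.IsNonBacktracking (p[i] :: t) := by
    have := (hp.drop i).take (k + 1)
    rwa [hdrop, List.take_succ_cons] at this
  have hget : ∀ a, a < k → t[a]? = p[i + 1 + a]? := by
    intro a ha
    rw [ht, List.getElem?_take, if_pos ha, List.getElem?_drop]
  have htn : t.Nodup := by
    rw [List.nodup_iff_getElem?_ne_getElem?]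
    intro a b hab hb h
    rw [htl] at hb
    rw [hget a (by omega), hget b hb] at h
    refine hmin (b - a) (by omega) ⟨by omega, i + 1 + a, by omega, ?_⟩
    rw [h]; congr 1; omega
  have hne : t ≠ [] := by
    intro h; rw [h] at htl; simp at htl; omega
  have hlast : t.getLast hne = p[i] := by
    have h1 : t.getLast? = p[i]? := by
      rw [List.getLast?_eq_getElem?, htl, hget _ (by omega), hik]
      congr 1; omega
    rw [List.getLast?_eq_some_getLast hne] at h1
    simpa [List.getElem?_eq_getElem (show i < p.length by omega)] using h1
  obtain ⟨w, hw, hwl⟩ := hnb.exists_cycle_of_closed htn hne hlast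
  have := SimpleGraph.girth_le_length hw
  omega

/-- Two paths that leave `x` in different directions glue to one path through `x`; the induction
moves the nodes of `p` across one at a time. -/
theorem reverse_append {x : V} {p q : List V} (hp : G.IsNonBacktracking (x :: p))
    (hq : G.IsNonBacktracking (x :: q)) (h : ∀ a, p[0]? = some a → q[0]? ≠ some a) :
    G.IsNonBacktracking (p.reverse ++ x :: q) := by
  induction p generalizing x q with
  | nil => simpa using hq
  | cons y p ih =>
    have hxy : G.Adj x y := hp.adj 0 x y (by simp) (by simp)
    have := ih (x := y) (q := x :: q) (by simpa using hp.drop 1)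
      (hq.cons_cons hxy.symm (h y (by simp))) ?_
    · simpa using this
    · intro a ha hxa
      simp only [List.getElem?_cons_zero, Option.some.injEq] at hxa
      exact hp.ne 0 x a (by simp) (by simpa using ha) hxa

/-- Below half the girth, a non-backtracking path is determined by its ends. -/
theorem eq_of_ends {m : ℕ} {p q : List V} (hp : G.IsNonBacktracking p)
    (hq : G.IsNonBacktracking q) (hpl : p.length = m + 1) (hql : q.length = m + 1)
    (h0 : p[0]? = q[0]?) (hm : p[m]? = q[m]?) (hg : 2 * m < G.girth) : p = q := by
  induction m generalizing p q with
  | zero =>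
    match p, q, hpl, hql with
    | [a], [b], _, _ => simpa using h0
  | succ m ih =>
    match p, q, hpl, hql with
    | c :: a :: s, c' :: b :: t, hpl, hql =>
      simp only [List.getElem?_cons_zero, Option.some.injEq] at h0
      subst h0
      simp only [List.getElem?_cons_succ] at hm
      simp only [List.length_cons, Nat.add_right_cancel_iff] at hpl hql
      by_cases hab : a = b
      · subst hab
        rw [ih (p := a :: s) (q := a :: t) (by simpa using hp.drop 1) (by simpa using hq.drop 1)
          (by simpa using hpl) (by simpa using hql) (by simp) hm (by omega)]
      -- Where the paths first diverge, gluing them gives a non-backtracking path of at most girth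
      -- many nodes whose two ends coincide.
      · exfalso
        have hnb := hp.reverse_append hq (by
          intro x hx
          simp only [List.getElem?_cons_zero, Option.some.injEq] at hx ⊢
          subst hx
          exact fun h => hab (Option.some.inj h).symm)
        have hnd := hnb.nodup (by simp; omega)
        have hlt : m < (a :: s).length := by simp; omega
        have hlt' : m < (b :: t).length := by simp; omega
        rw [List.getElem?_eq_getElem hlt, List.getElem?_eq_getElem hlt', Option.some.injEq] at hm
        refine (List.nodup_append.mp hnd).2.2 ((a :: s)[m]) ?_ ((b :: t)[m]) ?_ hm
        · rw [List.mem_reverse]; exact List.getElem_mem hlt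
        · exact List.mem_cons_of_mem _ (List.getElem_mem hlt')

end SimpleGraph.IsNonBacktracking

/-! ### Where a walk ends, and products along its strides -/

section Ends

variable {V : Type*} [Fintype V] {G : SimpleGraph V}

/-- The probability that a non-backtracking walk of `r` steps from `cur`, coming from `prev`,
ends at `w`. -/
noncomputable def endProb (G : SimpleGraph V) (r : ℕ) (prev : Option V) (cur w : V) : ℝ≥0∞ :=
  (nbWalkAux G r prev cur).prob fun p => p[r]? = some w

variable [DecidableRel G.Adj] {d : ℕ}

/-- At most one path in the support ends at `w`, and a single path has probability at most `(d -
1)⁻ʳ`. -/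
theorem endProb_le (hd : 3 ≤ d) (hG : G.IsRegularOfDegree d) {r : ℕ} (hr : 2 * r < G.girth)
    (prev : Option V) (cur w : V) :
    endProb G r prev cur w ≤ (((d - 1 : ℕ) : ℝ≥0∞)⁻¹) ^ r := by
  classical
  unfold endProb PMF.prob PMF.expect
  by_cases h : ∃ p ∈ (nbWalkAux G r prev cur).support, p[r]? = some w
  · obtain ⟨p, hp, hpw⟩ := h
    rw [tsum_eq_single p]
    · beta_reduce
      rw [if_pos hpw, mul_one]
      exact nbWalkAux_apply_le hd hG _ _ _ _
    · intro p' hne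
      by_cases hp' : p' ∈ (nbWalkAux G r prev cur).support
      · beta_reduce
        rw [if_neg, mul_zero]
        intro hw'
        obtain ⟨h1, h2, -⟩ := nbWalkAux_support hd hG _ _ _ hp
        obtain ⟨h1', h2', -⟩ := nbWalkAux_support hd hG _ _ _ hp'
        refine hne (h2'.eq_of_ends h2 h1' h1 ?_ (hw'.trans hpw.symm) hr)
        rw [nbWalkAux_getElem?_zero _ _ _ hp, nbWalkAux_getElem?_zero _ _ _ hp']
      · rw [(PMF.apply_eq_zero_iff _ _).mpr hp', zero_mul]
  · push Not at h
    refine (ENNReal.tsum_eq_zero.mpr fun p => ?_).trans_le zero_le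
    by_cases hp : p ∈ (nbWalkAux G r prev cur).support
    · beta_reduce
      rw [if_neg (h p hp), mul_zero]
    · rw [(PMF.apply_eq_zero_iff _ _).mpr hp, zero_mul]

theorem expect_end (hd : 3 ≤ d) (hG : G.IsRegularOfDegree d) (r : ℕ)
    (prev : Option V) (cur : V) (f : V → ℝ≥0∞) :
    ((nbWalkAux G r prev cur).expect fun p => (p[r]?).elim 0 f) =
      ∑ w, endProb G r prev cur w * f w := by
  classical
  simp only [endProb, PMF.prob, ← PMF.expect_mul_right, ← PMF.expect_finset_sum]
  refine PMF.expect_congr_support _ fun p hp => ?_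
  have hl := (nbWalkAux_support hd hG _ _ _ hp).1
  have hr : p[r]? = some p[r] := List.getElem?_eq_getElem (by omega)
  simp only [hr, Option.elim_some, Option.some.injEq, ite_mul, one_mul, zero_mul]
  simp

theorem sum_endProb (hd : 3 ≤ d) (hG : G.IsRegularOfDegree d) (r : ℕ)
    (prev : Option V) (cur : V) : ∑ w, endProb G r prev cur w = 1 := by
  have := expect_end hd hG r prev cur fun _ => 1
  simp only [mul_one] at this
  rw [← this]
  refine Eq.trans ?_ ((nbWalkAux G r prev cur).expect_const 1)
  refine PMF.expect_congr_support _ fun p hp => ?_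
  have hl := (nbWalkAux_support hd hG _ _ _ hp).1
  rw [List.getElem?_eq_getElem (by omega)]
  simp

/-- The product of `f` over the nodes visited at the times `r, 2 r, …, a r`. -/
noncomputable def strideProd {V : Type*} (f : V → ℝ≥0∞) (r a : ℕ) (p : List V) : ℝ≥0∞ :=
  ∏ i ∈ Finset.range a, (p[(i + 1) * r]?).elim 0 f

omit [DecidableRel G.Adj] in
-- This is the Markov property: after `m` steps a fresh walk of `L` steps starts. The bound is
-- required for every `prev`, since the fresh walk remembers its direction of arrival.
theorem expect_drop_le (L : ℕ) {F F₀ : List V → ℝ≥0∞} {B : ℝ≥0∞}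
    (h : ∀ prev cur, (nbWalkAux G L prev cur).expect F ≤ B * F₀ [cur]) (m : ℕ)
    (prev : Option V) (cur : V) :
    ((nbWalkAux G (m + L) prev cur).expect fun p => F (p.drop m)) ≤
      B * (nbWalkAux G m prev cur).expect fun p => F₀ (p.drop m) := by
  induction m generalizing prev cur with
  | zero =>
    simp only [zero_add, List.drop_zero]
    refine (h prev cur).trans ?_
    rw [nbWalkAux, PMF.expect_pure]
  | succ m ih =>
    rw [Nat.add_right_comm, nbWalkAux, nbWalkAux, PMF.expect_bind, PMF.expect_bind,
      ← PMF.expect_mul_left]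
    refine PMF.expect_mono _ fun w => ?_
    rw [PMF.expect_map, PMF.expect_map]
    simpa using ih (some cur) w

theorem expect_strideProd_le (hd : 3 ≤ d) (hG : G.IsRegularOfDegree d) {f : V → ℝ≥0∞} {r : ℕ}
    {B : ℝ≥0∞} (hB : ∀ prev cur, ∑ w, endProb G r prev cur w * f w ≤ B) (a : ℕ)
    (prev : Option V) (cur : V) :
    (nbWalkAux G (a * r) prev cur).expect (strideProd f r a) ≤ B ^ a := by
  induction a generalizing prev cur with
  | zero =>
    simp [strideProd, nbWalkAux, PMF.expect_pure]
  | succ a ih =>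
    have key := expect_drop_le (G := G) (a * r)
      (F := fun q => (q[0]?).elim 0 f * strideProd f r a q) (F₀ := fun q => (q[0]?).elim 0 f)
      (B := B ^ a) (by
        intro prev cur
        calc _ = (nbWalkAux G (a * r) prev cur).expect fun q => f cur * strideProd f r a q := by
              refine PMF.expect_congr_support _ fun p hp => ?_
              rw [nbWalkAux_getElem?_zero _ _ _ hp]; rfl
          _ ≤ _ := by
              rw [PMF.expect_mul_left, mul_comm]
              simp only [List.getElem?_cons_zero, Option.elim_some]
              gcongr
              exact ih prev cur) r prev cur
    calc (nbWalkAux G ((a + 1) * r) prev cur).expect (strideProd f r (a + 1))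
        = (nbWalkAux G (r + a * r) prev cur).expect fun p =>
            ((p.drop r)[0]?).elim 0 f * strideProd f r a (p.drop r) := by
          rw [show (a + 1) * r = r + a * r by ring]
          congr 1
          funext p
          rw [strideProd, strideProd, Finset.prod_range_succ', mul_comm]
          simp only [List.getElem?_drop, add_zero, zero_add, one_mul]
          congr 1
          refine Finset.prod_congr rfl fun i _ => ?_
          rw [show (i + 1 + 1) * r = r + (i + 1) * r by ring]
      _ ≤ B ^ a * B := by
          refine key.trans ?_
          gcongr
          simp only [List.getElem?_drop, add_zero]
          rw [expect_end hd hG]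
          exact hB prev cur
      _ = B ^ (a + 1) := (pow_succ _ _).symm

end Ends

/-! ### Splitting a walk at one of its nodes; the law of the placement -/

section Split

variable {V : Type*} [Fintype V] {G : SimpleGraph V} [DecidableRel G.Adj] {d : ℕ}

open Classical in
-- Seen from the node `v` visited at time `a`, a walk is a pair of walks from `v`, the first one
-- reversed. Near-uniformity on paths costs a factor `3 / 2` for each, hence `9 / 4`; dropping the
-- condition that the two walks leave `v` in different directions only enlarges the right-hand side.
theorem sum_expect_split_le (hd : 3 ≤ d) (hG : G.IsRegularOfDegree d) (a b : ℕ) (v : V)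
    (g₁ g₂ : List V → ℝ≥0∞) :
    ∑ u, (nbWalk G (a + b) u).expect (fun p => (if p[a]? = some v then 1 else 0) *
        (g₁ (p.take (a + 1)).reverse * g₂ (p.drop a))) ≤
      9 / 4 * ((nbWalk G a v).expect g₁ * (nbWalk G b v).expect g₂) := by
  set F : List V × List V → ℝ≥0∞ := fun q =>
    9 / 4 * ((nbWalk G a v q.1 * g₁ q.1) * (nbWalk G b v q.2 * g₂ q.2)) with hF
  have hinj : Function.Injective fun p : List V => ((p.take (a + 1)).reverse, p.drop a) := by
    intro p q h
    simp only [Prod.mk.injEq, List.reverse_inj] at h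
    have h1 : p.take a = q.take a := by
      have := congrArg (List.take a) h.1
      simpa [List.take_take] using this
    rw [← List.take_append_drop a p, ← List.take_append_drop a q, h1, h.2]
  have hsum : ∑' q, F q = 9 / 4 * ((nbWalk G a v).expect g₁ * (nbWalk G b v).expect g₂) := by
    rw [ENNReal.tsum_prod']
    simp only [hF, ENNReal.tsum_mul_left, ENNReal.tsum_mul_right]
    rfl
  rw [← hsum]
  refine le_trans ?_ (ENNReal.tsum_comp_le_tsum_of_injective hinj F)
  unfold PMF.expect
  rw [← Summable.tsum_finsetSum fun i _ => ENNReal.summable]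
  refine ENNReal.tsum_le_tsum fun p => ?_
  by_cases hp : ∃ u, p ∈ (nbWalk G (a + b) u).support
  · obtain ⟨u, hu⟩ := hp
    have h0 := nbWalkAux_getElem?_zero _ _ _ hu
    obtain ⟨hl, hnb, -⟩ := nbWalkAux_support hd hG _ _ _ hu
    rw [Finset.sum_eq_single u]
    · beta_reduce
      split_ifs with hv
      · rw [one_mul]
        have hq₁ : (nbWalk G (a + b) u) p ≤
            9 / 4 * (nbWalk G a v (p.take (a + 1)).reverse * nbWalk G b v (p.drop a)) := by
          calc (nbWalk G (a + b) u) p ≤ (((d - 1 : ℕ) : ℝ≥0∞)⁻¹) ^ (a + b) :=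
                nbWalkAux_apply_le hd hG _ _ _ _
            _ = (((d - 1 : ℕ) : ℝ≥0∞)⁻¹) ^ a * (((d - 1 : ℕ) : ℝ≥0∞)⁻¹) ^ b := pow_add _ _ _
            _ ≤ (3 / 2 * nbWalk G a v (p.take (a + 1)).reverse) *
                  (3 / 2 * nbWalk G b v (p.drop a)) := by
                refine mul_le_mul' (le_nbWalk_apply hd hG a (hnb.take _).reverse ?_ ?_)
                  (le_nbWalk_apply hd hG b (hnb.drop _) ?_ ?_)
                · simp; omega
                · rw [List.getElem?_reverse (by simp; omega), List.getElem?_take, ← hv]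
                  rw [List.length_take, min_eq_left (by omega), if_pos (by omega)]
                  congr 1
                · simp; omega
                · rw [List.getElem?_drop, ← hv]; simp
            _ = 9 / 4 * (nbWalk G a v (p.take (a + 1)).reverse * nbWalk G b v (p.drop a)) := by
                have : (3 / 2 : ℝ≥0∞) * (3 / 2) = 9 / 4 := by
                  rw [ENNReal.div_eq_inv_mul, ENNReal.div_eq_inv_mul, mul_mul_mul_comm,
                    ← ENNReal.mul_inv (by simp) (by simp)]
                  norm_num
                rw [← this]; ring
        calc _ ≤ 9 / 4 * (nbWalk G a v (p.take (a + 1)).reverse * nbWalk G b v (p.drop a)) *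
              (g₁ (p.take (a + 1)).reverse * g₂ (p.drop a)) := by gcongr
          _ = _ := by simp only [hF]; ring
      · simp
    · intro u' _ hne
      have : nbWalk G (a + b) u' p = 0 := by
        rw [PMF.apply_eq_zero_iff]
        intro h
        have := nbWalkAux_getElem?_zero _ _ _ h
        rw [h0] at this
        exact hne (Option.some.inj this).symm
      rw [this, zero_mul]
    · simp
  · push Not at hp
    refine (Finset.sum_eq_zero fun u _ => ?_).trans_le zero_le
    rw [(PMF.apply_eq_zero_iff _ _).mpr (hp u), zero_mul]

/-- The law of the node that receives the next ball when the loads are `x`. -/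
noncomputable def placement [Nonempty V] (G : SimpleGraph V) (l r : ℕ) (x : V → ℕ) : PMF V :=
  (PMF.uniformOfFintype V).bind fun u => (nbWalk G (l * r) u).bind fun p =>
    uniformOr (leastLoaded x (potentialChoices l r p)) u

omit [DecidableRel G.Adj] in
open Classical in
theorem allocateBall_eq_map [Nonempty V] (l r : ℕ) (x : V → ℕ) :
    allocateBall G l r x =
      (placement G l r x).map fun v => Function.update x v (x v + 1) := by
  simp only [allocateBall, placement, PMF.map_bind]

omit [DecidableRel G.Adj] in
theorem placement_apply [Nonempty V] (l r : ℕ) (x : V → ℕ) (v : V) :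
    placement G l r x v = (Fintype.card V : ℝ≥0∞)⁻¹ * ∑ u, (nbWalk G (l * r) u).expect fun p =>
      uniformOr (leastLoaded x (potentialChoices l r p)) u v := by
  simp only [placement, PMF.bind_apply, PMF.uniformOfFintype_apply, tsum_fintype, Finset.mul_sum]
  rfl

theorem mem_potentialChoices {l r : ℕ} {p : List V} {v : V} :
    v ∈ potentialChoices l r p ↔ ∃ j ≤ l, p[j * r]? = some v := by
  simp [potentialChoices]

omit [Fintype V] in
theorem mem_leastLoaded {x : V → ℕ} {S : Finset V} {v : V} :
    v ∈ leastLoaded x S ↔ v ∈ S ∧ ∀ u ∈ S, x v ≤ x u := by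
  simp [leastLoaded]

omit [Fintype V] in
theorem leastLoaded_nonempty {x : V → ℕ} {S : Finset V} (h : S.Nonempty) :
    (leastLoaded x S).Nonempty := by
  obtain ⟨v, hv, hmin⟩ := S.exists_min_image x h
  exact ⟨v, mem_leastLoaded.mpr ⟨hv, hmin⟩⟩

omit [DecidableRel G.Adj] in
theorem potentialChoices_nonempty {l r L : ℕ} {prev : Option V} {u : V} {p : List V}
    (hp : p ∈ (nbWalkAux G L prev u).support) : (potentialChoices l r p).Nonempty :=
  ⟨u, mem_potentialChoices.mpr ⟨0, zero_le, by simpa using nbWalkAux_getElem?_zero _ _ _ hp⟩⟩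

omit [Fintype V] in
/-- The weights `f` multiplied over all potential choices factor at the `j`-th one. -/
theorem prod_choices_eq {l r j : ℕ} (hj : j ≤ l) {p : List V} (hp : p.length = l * r + 1)
    {v : V} (hv : p[j * r]? = some v) (f : V → ℝ≥0∞) :
    ∏ i ∈ Finset.range (l + 1), (p[i * r]?).elim 0 f =
      f v * (strideProd f r j (p.take (j * r + 1)).reverse *
        strideProd f r (l - j) (p.drop (j * r))) := by
  have hjr : j * r ≤ l * r := Nat.mul_le_mul_right _ hj
  rw [show l + 1 = j + ((l - j) + 1) by omega, Finset.prod_range_add, Finset.prod_range_succ',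
    add_zero, hv, Option.elim_some]
  have h1 : ∏ i ∈ Finset.range j, (p[i * r]?).elim 0 f =
      strideProd f r j (p.take (j * r + 1)).reverse := by
    rw [strideProd, ← Finset.prod_range_reflect]
    refine Finset.prod_congr rfl fun i hi => ?_
    rw [Finset.mem_range] at hi
    have h2 : (i + 1) * r ≤ j * r := Nat.mul_le_mul_right _ hi
    have h3 : (j - 1 - i) * r = j * r - (i + 1) * r := by
      rw [← Nat.sub_mul]; congr 1; omega
    rw [List.getElem?_reverse (by rw [List.length_take, hp]; omega), List.getElem?_take,
      List.length_take, hp, min_eq_left (by omega), if_pos (by omega), h3]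
    congr 2
  have h2 : ∏ i ∈ Finset.range (l - j), (p[(j + (i + 1)) * r]?).elim 0 f =
      strideProd f r (l - j) (p.drop (j * r)) := by
    rw [strideProd]
    refine Finset.prod_congr rfl fun i _ => ?_
    rw [List.getElem?_drop, add_mul j]
  rw [h1, h2]; ring

end Split

/-! ### The rate at which a node receives balls -/

section Rate

variable {V : Type*} [Fintype V] {G : SimpleGraph V} [DecidableRel G.Adj] {d : ℕ}

/-- Every `r`-step non-backtracking walk ends with probability at most `δ` in a node of load at
least `k`. -/
def SparseAbove (G : SimpleGraph V) (r k : ℕ) (δ : ℝ≥0∞) (x : V → ℕ) : Prop :=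
  ∀ prev cur, ∑ w, endProb G r prev cur w * (if k ≤ x w then 1 else 0) ≤ δ

open Classical in
-- Markov's inequality in product form handles the case that at least half of the choices are above
-- level `k`: each such choice contributes `256 = 16 ^ 2`, so the product beats `16 ^ (l + 1)`.
-- Otherwise `v` has load `k` and at least half of the choices tie with it. The sum runs over the
-- possible positions of `v` on the walk.
theorem uniformOr_leastLoaded_le (hd : 3 ≤ d) (hG : G.IsRegularOfDegree d) {l r : ℕ}
    (hr : 0 < r) (hg : l * r < G.girth) {x : V → ℕ} {k : ℕ} {v : V} (hk : k ≤ x v) {u : V}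
    {p : List V} (hp : p ∈ (nbWalk G (l * r) u).support) :
    uniformOr (leastLoaded x (potentialChoices l r p)) u v ≤
      ∑ j ∈ Finset.range (l + 1), (if p[j * r]? = some v then 1 else 0) *
        (((16 : ℝ≥0∞) ^ (l + 1))⁻¹ * ∏ i ∈ Finset.range (l + 1),
            (p[i * r]?).elim 0 (fun w => if k + 1 ≤ x w then 256 else 1) +
          (if x v = k then 2 / (l + 1) else 0 : ℝ≥0∞)) := by
  obtain ⟨hl, hnb, -⟩ := nbWalkAux_support hd hG _ _ _ hp
  have hnd : p.Nodup := hnb.nodup (by omega)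
  rw [uniformOr_apply (leastLoaded_nonempty (potentialChoices_nonempty hp))]
  by_cases hv : v ∈ leastLoaded x (potentialChoices l r p)
  swap
  · rw [if_neg hv]; exact zero_le
  rw [if_pos hv]
  have hvl := hv
  rw [mem_leastLoaded] at hv
  obtain ⟨hvp, hmin⟩ := hv
  obtain ⟨j, hj, hjv⟩ := mem_potentialChoices.mp hvp
  refine le_trans ?_ (Finset.single_le_sum (fun _ _ => zero_le)
    (Finset.mem_range.mpr (Nat.lt_succ_of_le hj)))
  rw [if_pos hjv, one_mul]
  have hlt : ∀ i ∈ Finset.range (l + 1), i * r < p.length := fun i hi => by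
    rw [Finset.mem_range] at hi
    have : i * r ≤ l * r := Nat.mul_le_mul_right _ (by omega)
    omega
  have hge : ∀ i ∈ Finset.range (l + 1), ∀ w, p[i * r]? = some w → x v ≤ x w := fun i hi w hw =>
    hmin w (mem_potentialChoices.mpr ⟨i, by simpa [Nat.lt_succ_iff] using hi, hw⟩)
  set S := (Finset.range (l + 1)).filter fun i => ∃ w, p[i * r]? = some w ∧ k + 1 ≤ x w with hS
  have hprod : ∏ i ∈ Finset.range (l + 1),
      (p[i * r]?).elim 0 (fun w => if k + 1 ≤ x w then (256 : ℝ≥0∞) else 1) =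
        16 ^ (2 * S.card) := by
    rw [pow_mul, show (16 : ℝ≥0∞) ^ 2 = 256 by norm_num, ← Finset.prod_const, hS,
      Finset.prod_filter]
    refine Finset.prod_congr rfl fun i hi => ?_
    rw [List.getElem?_eq_getElem (hlt i hi)]
    simp
  have hc1 : ((leastLoaded x (potentialChoices l r p)).card : ℝ≥0∞)⁻¹ ≤ 1 := by
    rw [ENNReal.inv_le_one]
    exact_mod_cast Finset.card_pos.mpr ⟨v, hvl⟩
  by_cases hbig : l + 1 ≤ 2 * S.card
  · refine hc1.trans (le_trans ?_ le_self_add)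
    rw [hprod, ← ENNReal.div_eq_inv_mul, ENNReal.le_div_iff_mul_le (by simp) (by simp), one_mul]
    exact pow_le_pow_right₀ (by norm_num) hbig
  -- If the least loaded choice `v` had load above `k`, all choices would lie in `S`.
  · have hxk : x v = k := by
      by_contra hne
      have : S = Finset.range (l + 1) := by
        rw [hS, Finset.filter_true_of_mem]
        intro i hi
        refine ⟨_, List.getElem?_eq_getElem (hlt i hi), ?_⟩
        have := hge i hi _ (List.getElem?_eq_getElem (hlt i hi))
        omega
      rw [this, Finset.card_range] at hbig
      omega
    rw [if_pos hxk]
    refine le_trans ?_ le_add_self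
    have hcard : l + 1 - S.card ≤ (leastLoaded x (potentialChoices l r p)).card := by
      have h1 : (Finset.range (l + 1) \ S).card = l + 1 - S.card := by
        rw [Finset.card_sdiff_of_subset (Finset.filter_subset _ _), Finset.card_range]
      rw [← h1]
      refine Finset.card_le_card_of_injOn (fun i => (p[i * r]?).getD v) ?_ ?_
      · intro i hi
        rw [Finset.mem_coe, Finset.mem_sdiff] at hi
        have hw := List.getElem?_eq_getElem (hlt i hi.1)
        have hwk : ¬ k + 1 ≤ x (p[i * r]'(hlt i hi.1)) := fun h =>
          hi.2 (Finset.mem_filter.mpr ⟨hi.1, _, hw, h⟩)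
        have hwp : p[i * r]'(hlt i hi.1) ∈ potentialChoices l r p :=
          mem_potentialChoices.mpr ⟨i, by simpa [Nat.lt_succ_iff] using hi.1, hw⟩
        simp only [hw, Option.getD_some, Finset.mem_coe, mem_leastLoaded]
        refine ⟨hwp, fun u hu => ?_⟩
        have := hmin u hu
        omega
      · intro i hi i' hi' h
        rw [Finset.mem_coe, Finset.mem_sdiff] at hi hi'
        simp only [List.getElem?_eq_getElem (hlt i hi.1), List.getElem?_eq_getElem (hlt i' hi'.1),
          Option.getD_some] at h
        exact Nat.eq_of_mul_eq_mul_right hr ((hnd.getElem_inj_iff).mp h)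
    rw [← ENNReal.inv_div (by simp) (by simp), ENNReal.inv_le_inv,
      ENNReal.div_le_iff (by simp) (by simp)]
    exact_mod_cast (by omega : l + 1 ≤ (leastLoaded x (potentialChoices l r p)).card * 2)

open Classical in
-- Each of the `l + 1` positions of `v` costs `9 / 4` by splitting the walk there. The tie term
-- becomes `(l + 1) * (9 / 4) * (2 / (l + 1)) = 9 / 2`, and the product term `36 * (l + 1) / 8 ^ l`,
-- which is below `4⁻ˡ` for `l ≥ 9`.
theorem placement_le [Nonempty V] (hd : 3 ≤ d) (hG : G.IsRegularOfDegree d) {l r : ℕ}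
    (hr : 0 < r) (hl : 9 ≤ l) (hg : l * r < G.girth) {x : V → ℕ} {k : ℕ}
    (hx : SparseAbove G r (k + 1) 256⁻¹ x) {v : V} (hk : k ≤ x v) :
    placement G l r x v ≤
      (Fintype.card V : ℝ≥0∞)⁻¹ * ((4 ^ l)⁻¹ + if x v = k then 9 / 2 else 0) := by
  rw [placement_apply]
  gcongr
  set f : V → ℝ≥0∞ := fun w => if k + 1 ≤ x w then 256 else 1 with hf
  set c : ℝ≥0∞ := if x v = k then 2 / (l + 1) else 0 with hc
  -- Density at most `1 / 256` is exactly what keeps the mean of the weight `256` bounded: `1 + 256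
  -- / 256 = 2` per stride.
  have hB : ∀ prev cur, ∑ w, endProb G r prev cur w * f w ≤ 2 := by
    intro prev cur
    calc ∑ w, endProb G r prev cur w * f w
        ≤ ∑ w, (endProb G r prev cur w +
            256 * (endProb G r prev cur w * if k + 1 ≤ x w then 1 else 0)) := by
          refine Finset.sum_le_sum fun w _ => ?_
          simp only [hf]
          split_ifs
          · rw [mul_one, mul_comm]; exact le_add_self
          · simp
      _ ≤ 1 + 256 * 256⁻¹ := by
          rw [Finset.sum_add_distrib, ← Finset.mul_sum, sum_endProb hd hG]
          gcongr
          exact hx prev cur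
      _ = 2 := by rw [ENNReal.mul_inv_cancel (by simp) (by simp)]; norm_num
  have hfv : f v ≤ 256 := by
    simp only [hf]; split_ifs
    · exact le_rfl
    · norm_num
  have hterm : ∀ j ∈ Finset.range (l + 1), ∑ u, (nbWalk G (l * r) u).expect (fun p =>
      (if p[j * r]? = some v then 1 else 0) * (((16 : ℝ≥0∞) ^ (l + 1))⁻¹ *
        ∏ i ∈ Finset.range (l + 1), (p[i * r]?).elim 0 f + c)) ≤
      9 / 4 * (((16 : ℝ≥0∞) ^ (l + 1))⁻¹ * (256 * 2 ^ l) + c) := by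
    intro j hj
    have hj' : j ≤ l := by simpa [Nat.lt_succ_iff] using hj
    have hjl : l * r = j * r + (l - j) * r := by rw [← add_mul]; congr 1; omega
    have h1 := sum_expect_split_le hd hG (j * r) ((l - j) * r) v (strideProd f r j)
      (strideProd f r (l - j))
    have h2 := sum_expect_split_le hd hG (j * r) ((l - j) * r) v (fun _ => 1) (fun _ => 1)
    rw [← hjl] at h1 h2
    simp only [PMF.expect_const, mul_one] at h2
    have h3 : (nbWalk G (j * r) v).expect (strideProd f r j) *
        (nbWalk G ((l - j) * r) v).expect (strideProd f r (l - j)) ≤ 2 ^ l := by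
      calc _ ≤ (2 : ℝ≥0∞) ^ j * 2 ^ (l - j) :=
            mul_le_mul' (expect_strideProd_le hd hG hB _ _ _) (expect_strideProd_le hd hG hB _ _ _)
        _ = 2 ^ l := by rw [← pow_add]; congr 1; omega
    calc _ = ((16 : ℝ≥0∞) ^ (l + 1))⁻¹ * f v * ∑ u, (nbWalk G (l * r) u).expect (fun p =>
            (if p[j * r]? = some v then 1 else 0) * (strideProd f r j (p.take (j * r + 1)).reverse *
              strideProd f r (l - j) (p.drop (j * r)))) +
          c * ∑ u, (nbWalk G (l * r) u).expect (fun p => if p[j * r]? = some v then 1 else 0) := by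
          rw [Finset.mul_sum, Finset.mul_sum, ← Finset.sum_add_distrib]
          refine Finset.sum_congr rfl fun u _ => ?_
          rw [← PMF.expect_mul_left, ← PMF.expect_mul_left, ← PMF.expect_add]
          refine PMF.expect_congr_support _ fun p hp => ?_
          obtain ⟨hpl, -, -⟩ := nbWalkAux_support hd hG _ _ _ hp
          by_cases hv : p[j * r]? = some v
          · rw [if_pos hv, prod_choices_eq hj' hpl hv]; ring
          · rw [if_neg hv]; simp
      _ ≤ ((16 : ℝ≥0∞) ^ (l + 1))⁻¹ * 256 * (9 / 4 * 2 ^ l) + c * (9 / 4) := by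
          gcongr
          exact h1.trans (by gcongr)
      _ = _ := by ring
  calc _ ≤ ∑ u, (nbWalk G (l * r) u).expect fun p => ∑ j ∈ Finset.range (l + 1),
        (if p[j * r]? = some v then 1 else 0) * (((16 : ℝ≥0∞) ^ (l + 1))⁻¹ *
          ∏ i ∈ Finset.range (l + 1), (p[i * r]?).elim 0 f + c) :=
        Finset.sum_le_sum fun u _ => PMF.expect_mono_support _ fun p hp =>
          uniformOr_leastLoaded_le hd hG hr hg hk hp
    _ = ∑ j ∈ Finset.range (l + 1), ∑ u, (nbWalk G (l * r) u).expect (fun p =>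
        (if p[j * r]? = some v then 1 else 0) * (((16 : ℝ≥0∞) ^ (l + 1))⁻¹ *
          ∏ i ∈ Finset.range (l + 1), (p[i * r]?).elim 0 f + c)) := by
        rw [Finset.sum_comm]
        exact Finset.sum_congr rfl fun u _ => PMF.expect_finset_sum _ _ _
    _ ≤ ∑ _j ∈ Finset.range (l + 1), 9 / 4 * (((16 : ℝ≥0∞) ^ (l + 1))⁻¹ * (256 * 2 ^ l) + c) :=
        Finset.sum_le_sum hterm
    _ = (l + 1) * (9 / 4) * ((16 : ℝ≥0∞) ^ (l + 1))⁻¹ * (256 * 2 ^ l) +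
          9 / 4 * ((l + 1) * c) := by
        rw [Finset.sum_const, Finset.card_range, nsmul_eq_mul]; push_cast; ring
    _ ≤ (4 ^ l)⁻¹ + if x v = k then 9 / 2 else 0 := by
        refine add_le_add ?_ ?_
        · have hnat : 36 * (l + 1) ≤ 2 ^ l := by
            clear * - hl
            induction l, hl using Nat.le_induction with
            | base => norm_num
            | succ l hl ih => rw [pow_succ]; omega
          have hnat' : ((l + 1 : ℝ≥0∞) * 9) * (256 * 2 ^ l) * 4 ^ l ≤ 16 ^ (l + 1) * 4 := by
            have : (l + 1) * 9 * (256 * 2 ^ l) * 4 ^ l ≤ 16 ^ (l + 1) * 4 := by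
              calc (l + 1) * 9 * (256 * 2 ^ l) * 4 ^ l = (36 * (l + 1)) * (64 * (2 ^ l * 4 ^ l)) := by
                    ring
                _ ≤ 2 ^ l * (64 * (2 ^ l * 4 ^ l)) := by gcongr
                _ = 16 ^ (l + 1) * 4 := by
                    rw [show (4 : ℕ) = 2 ^ 2 by norm_num, show (16 : ℕ) = 2 ^ 4 by norm_num,
                      show (64 : ℕ) = 2 ^ 6 by norm_num, ← pow_mul, ← pow_mul]
                    ring
            exact_mod_cast this
          rw [ENNReal.le_inv_iff_mul_le]
          calc (l + 1) * (9 / 4) * ((16 : ℝ≥0∞) ^ (l + 1))⁻¹ * (256 * 2 ^ l) * 4 ^ l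
              = ((l + 1 : ℝ≥0∞) * 9) * (256 * 2 ^ l) * 4 ^ l * ((16 ^ (l + 1))⁻¹ * 4⁻¹) := by
                rw [div_eq_mul_inv]; ring
            _ ≤ (16 ^ (l + 1) * 4) * ((16 ^ (l + 1))⁻¹ * 4⁻¹) := by gcongr
            _ = (16 ^ (l + 1) * (16 ^ (l + 1))⁻¹) * (4 * 4⁻¹) := by ring
            _ = 1 := by
                rw [ENNReal.mul_inv_cancel (by simp) (by simp),
                  ENNReal.mul_inv_cancel (by simp) (by simp), one_mul]
        · rw [hc]
          split_ifs
          · rw [ENNReal.mul_div_cancel (by simp) (by simp), ← ENNReal.mul_div_right_comm]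
            rw [ENNReal.div_le_iff (by simp) (by simp), ← ENNReal.mul_div_right_comm,
              ENNReal.le_div_iff_mul_le (by simp) (by simp)]
            norm_num
          · simp

theorem placement_le_six [Nonempty V] (hd : 3 ≤ d) (hG : G.IsRegularOfDegree d) {l r : ℕ}
    (hr : 0 < r) (hl : 9 ≤ l) (hg : l * r < G.girth) {x : V → ℕ} {k : ℕ}
    (hx : SparseAbove G r (k + 1) 256⁻¹ x) {v : V} (hk : k ≤ x v) :
    placement G l r x v ≤ (Fintype.card V : ℝ≥0∞)⁻¹ * 6 := by
  refine (placement_le hd hG hr hl hg hx hk).trans ?_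
  gcongr
  have h1 : ((4 : ℝ≥0∞) ^ l)⁻¹ ≤ 1 := ENNReal.inv_le_one.mpr (one_le_pow₀ (by norm_num))
  have h2 : (if x v = k then 9 / 2 else 0 : ℝ≥0∞) ≤ 5 := by
    split_ifs
    · rw [ENNReal.div_le_iff (by simp) (by simp)]; norm_num
    · simp
  calc _ ≤ (1 : ℝ≥0∞) + 5 := add_le_add h1 h2
    _ = 6 := by norm_num

theorem placement_le_inv_four_pow [Nonempty V] (hd : 3 ≤ d) (hG : G.IsRegularOfDegree d)
    {l r : ℕ} (hr : 0 < r) (hl : 9 ≤ l) (hg : l * r < G.girth) {x : V → ℕ} {k : ℕ}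
    (hx : SparseAbove G r (k + 1) 256⁻¹ x) {v : V} (hk : k + 1 ≤ x v) :
    placement G l r x v ≤ (Fintype.card V : ℝ≥0∞)⁻¹ * (4 ^ l)⁻¹ := by
  have := placement_le hd hG hr hl hg hx (v := v) (by omega)
  rwa [if_neg (by omega), add_zero] at this

end Rate

/-! ### Potentials with small drift -/

section Drift

variable {V : Type*} [Fintype V] [Nonempty V] {G : SimpleGraph V}

/-- The law of the loads when `t` balls are allocated from the loads `x`. -/
noncomputable def loadsFrom (G : SimpleGraph V) (l r : ℕ) : ℕ → (V → ℕ) → PMF (V → ℕ)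
  | 0, x => PMF.pure x
  | t + 1, x => (allocateBall G l r x).bind (loadsFrom G l r t)

theorem loads_add (l r s t : ℕ) :
    loads G l r (s + t) = (loads G l r s).bind (loadsFrom G l r t) := by
  induction t generalizing s with
  | zero =>
    refine (PMF.bind_pure _).symm.trans ?_
    rfl
  | succ t ih =>
    rw [show s + (t + 1) = (s + 1) + t by ring, ih, loads, PMF.bind_bind]
    rfl

theorem prob_loadsFrom_of_absorbing {l r : ℕ} {B : (V → ℕ) → Prop}
    (hB : ∀ x, B x → ∀ y ∈ (allocateBall G l r x).support, B y) (t : ℕ) {x : V → ℕ} (hx : B x) :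
    (loadsFrom G l r t x).prob B = 1 := by
  classical
  induction t generalizing x with
  | zero => simp [loadsFrom, PMF.prob, PMF.expect_pure, hx]
  | succ t ih =>
    rw [loadsFrom, PMF.prob_bind]
    exact (PMF.expect_congr_support _ fun y hy => ih (hB x hx y hy)).trans (PMF.expect_const _ _)

/-- A potential that grows at most by a factor `1 + β` per ball, as long as neither `B₁` nor the
absorbing `B₂` occurs, bounds the probability of `B₁` up to that of `B₂`. -/
theorem prob_loadsFrom_le_of_drift {l r : ℕ} {B₁ B₂ : (V → ℕ) → Prop} {Φ : (V → ℕ) → ℝ≥0∞}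
    {β : ℝ≥0∞} (hB₂ : ∀ x, B₂ x → ∀ y ∈ (allocateBall G l r x).support, B₂ y)
    (hΦ : ∀ x, ¬ B₁ x → ¬ B₂ x → (allocateBall G l r x).expect Φ ≤ (1 + β) * Φ x)
    (hB₁ : ∀ x, B₁ x → 1 ≤ Φ x) (t : ℕ) (x : V → ℕ) :
    (loadsFrom G l r t x).prob B₁ ≤ (1 + β) ^ t * Φ x + (loadsFrom G l r t x).prob B₂ := by
  classical
  by_cases h₁ : B₁ x
  · refine (PMF.prob_le_one _ _).trans (le_trans ?_ le_self_add)
    exact one_le_mul (one_le_pow₀ le_self_add) (hB₁ x h₁)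
  by_cases h₂ : B₂ x
  · rw [prob_loadsFrom_of_absorbing hB₂ t h₂]
    exact (PMF.prob_le_one _ _).trans le_add_self
  induction t generalizing x with
  | zero => simp [loadsFrom, PMF.prob, PMF.expect_pure, h₁]
  | succ t ih =>
    rw [loadsFrom, PMF.prob_bind, PMF.prob_bind]
    calc (allocateBall G l r x).expect (fun y => (loadsFrom G l r t y).prob B₁)
        ≤ (allocateBall G l r x).expect (fun y => (1 + β) ^ t * Φ y +
            (loadsFrom G l r t y).prob B₂) := by
          refine PMF.expect_mono _ fun y => ?_
          by_cases h₁ : B₁ y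
          · refine (PMF.prob_le_one _ _).trans (le_trans ?_ le_self_add)
            exact one_le_mul (one_le_pow₀ le_self_add) (hB₁ y h₁)
          by_cases h₂ : B₂ y
          · rw [prob_loadsFrom_of_absorbing hB₂ t h₂]
            exact (PMF.prob_le_one _ _).trans le_add_self
          exact ih y h₁ h₂
      _ ≤ _ := by
          rw [PMF.expect_add, PMF.expect_mul_left, pow_succ, mul_assoc]
          gcongr
          exact hΦ x h₁ h₂

theorem le_of_mem_support_allocateBall {l r : ℕ} {x y : V → ℕ}
    (h : y ∈ (allocateBall G l r x).support) : x ≤ y := by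
  classical
  rw [allocateBall_eq_map, PMF.mem_support_map_iff] at h
  obtain ⟨v, -, rfl⟩ := h
  intro w
  by_cases hw : w = v
  · subst hw; simp
  · simp [hw]

/-- A ball changes the factor of a single node, so the relative growths `g` add up, weighted by the
placement law. -/
theorem expect_allocateBall_prod_le {l r : ℕ} {φ : V → ℕ → ℝ≥0∞} {g : V → ℝ≥0∞} {x : V → ℕ}
    {β : ℝ≥0∞} (hφ : ∀ v, φ v (x v + 1) ≤ (1 + g v) * φ v (x v))
    (hβ : ∑ v, placement G l r x v * g v ≤ β) :
    (allocateBall G l r x).expect (fun y => ∏ w, φ w (y w)) ≤ (1 + β) * ∏ w, φ w (x w) := by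
  classical
  rw [allocateBall_eq_map, PMF.expect_map]
  calc (placement G l r x).expect (fun v => ∏ w, φ w (Function.update x v (x v + 1) w))
      ≤ (placement G l r x).expect (fun v => (1 + g v) * ∏ w, φ w (x w)) := by
        refine PMF.expect_mono _ fun v => ?_
        rw [← Finset.mul_prod_erase Finset.univ (fun w => φ w (x w)) (Finset.mem_univ v),
          ← Finset.mul_prod_erase Finset.univ _ (Finset.mem_univ v), ← mul_assoc]
        refine mul_le_mul' ?_ (le_of_eq ?_)
        · simpa using hφ v
        · refine Finset.prod_congr rfl fun w hw => ?_
          rw [Function.update_of_ne (Finset.ne_of_mem_erase hw)]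
    _ ≤ (1 + β) * ∏ w, φ w (x w) := by
        rw [PMF.expect_mul_right, PMF.expect_add, PMF.expect_const]
        gcongr
        rwa [PMF.expect, tsum_fintype]

end Drift

/-! ### Concentration of the density of a level -/

section Sparse

variable {V : Type*} [Fintype V] {G : SimpleGraph V}

theorem Real.exp_half_sum_le_prod {ι : Type*} (s : Finset ι) {z : ι → ℝ}
    (h0 : ∀ i ∈ s, 0 ≤ z i) (h1 : ∀ i ∈ s, z i ≤ 1) :
    Real.exp ((∑ i ∈ s, z i) / 2) ≤ ∏ i ∈ s, (1 + z i) := by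
  rw [Finset.sum_div, Real.exp_sum]
  refine Finset.prod_le_prod (fun _ _ => (Real.exp_pos _).le) fun i hi => ?_
  have h2 := Real.one_sub_le_exp_neg (z i / 2)
  have h3 := h0 i hi
  have h4 := h1 i hi
  rw [Real.exp_neg, le_inv_comm₀ (by linarith) (Real.exp_pos _)] at h2
  refine h2.trans ?_
  rw [inv_le_iff_one_le_mul₀ (by linarith)]
  nlinarith

theorem ENNReal.exp_half_le_prod {ι : Type*} (s : Finset ι) {z : ι → ℝ≥0∞}
    (h1 : ∀ i ∈ s, z i ≤ 1) {c : ℝ≥0} (hc : (c : ℝ≥0∞) ≤ ∑ i ∈ s, z i) :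
    ENNReal.ofReal (Real.exp (c / 2)) ≤ ∏ i ∈ s, (1 + z i) := by
  have hfin : ∀ i ∈ s, z i ≠ ∞ := fun i hi => ne_top_of_le_ne_top ENNReal.one_ne_top (h1 i hi)
  have h := Real.exp_half_sum_le_prod s (z := fun i => (z i).toReal)
    (fun _ _ => ENNReal.toReal_nonneg) (fun i hi => ENNReal.toReal_le_of_le_ofReal zero_le_one
      (by simpa using h1 i hi))
  have hc' : (c : ℝ) ≤ ∑ i ∈ s, (z i).toReal := by
    rw [← ENNReal.toReal_sum hfin]
    simpa using ENNReal.toReal_mono (ENNReal.sum_ne_top.mpr hfin) hc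
  calc ENNReal.ofReal (Real.exp (c / 2)) ≤ ENNReal.ofReal (∏ i ∈ s, (1 + (z i).toReal)) := by
        refine ENNReal.ofReal_le_ofReal (le_trans ?_ h)
        gcongr
    _ = ∏ i ∈ s, (1 + z i) := by
        rw [ENNReal.ofReal_prod_of_nonneg fun i _ => by positivity]
        refine Finset.prod_congr rfl fun i hi => ?_
        rw [ENNReal.ofReal_add zero_le_one ENNReal.toReal_nonneg, ENNReal.ofReal_one,
          ENNReal.ofReal_toReal (hfin i hi)]

theorem SparseAbove.anti {r k : ℕ} {δ : ℝ≥0∞} {x y : V → ℕ} (h : SparseAbove G r k δ y)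
    (hxy : x ≤ y) : SparseAbove G r k δ x := by
  intro prev cur
  refine le_trans (Finset.sum_le_sum fun w _ => ?_) (h prev cur)
  gcongr
  by_cases hw : k ≤ x w
  · rw [if_pos hw, if_pos (hw.trans (hxy w))]
  · rw [if_neg hw]; exact zero_le

theorem SparseAbove.mono {r k k' : ℕ} {δ δ' : ℝ≥0∞} {x : V → ℕ} (h : SparseAbove G r k δ x)
    (hk : k ≤ k') (hδ : δ ≤ δ') : SparseAbove G r k' δ' x := by
  intro prev cur
  refine (le_trans (Finset.sum_le_sum fun w _ => ?_) (h prev cur)).trans hδ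
  gcongr
  by_cases hw : k' ≤ x w
  · rw [if_pos hw, if_pos (hk.trans hw)]
  · rw [if_neg hw]; exact zero_le

variable [Nonempty V] [DecidableRel G.Adj] {d : ℕ}

/-- A Chernoff bound with parameter `λ = (d - 1) ^ r`, the largest for which `endProb_le` keeps all
weights `λ * endProb` at most `1`. A ball multiplies the potential in expectation by at most `1 + ρ
λ / n`, while a density increase above `δ₁` makes it at least `exp (λ δ₁ / 2)`. The factor `(n + 1)
* n` is the union bound over pairs of `prev` and `cur`. -/
theorem prob_not_sparseAbove_le (hd : 3 ≤ d) (hG : G.IsRegularOfDegree d) {l r : ℕ}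
    (hr : 2 * r < G.girth) {B₂ : (V → ℕ) → Prop}
    (hB₂ : ∀ x, B₂ x → ∀ y ∈ (allocateBall G l r x).support, B₂ y) {κ : ℕ} {ρ : ℝ≥0∞}
    {δ₀ : ℝ≥0} {δ₁ : ℝ≥0} {x₀ : V → ℕ} (h₀ : SparseAbove G r (κ + 1) δ₀ x₀)
    (hrate : ∀ x, SparseAbove G r (κ + 1) (δ₀ + δ₁) x → ¬ B₂ x → ∀ v, κ ≤ x v →
      placement G l r x v ≤ (Fintype.card V : ℝ≥0∞)⁻¹ * ρ) (t : ℕ) :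
    (loadsFrom G l r t x₀).prob (fun x => ¬ SparseAbove G r (κ + 1) (δ₀ + δ₁) x) ≤
      (1 + (Fintype.card V : ℝ≥0∞)⁻¹ * ρ * ((d - 1 : ℕ) : ℝ≥0∞) ^ r) ^ t *
        (((Fintype.card V + 1) * Fintype.card V : ℕ) *
          ENNReal.ofReal (Real.exp (-(((d - 1 : ℕ) : ℝ≥0) ^ r * δ₁ : ℝ≥0) / 2))) +
      (loadsFrom G l r t x₀).prob B₂ := by
  classical
  set lam : ℝ≥0∞ := ((d - 1 : ℕ) : ℝ≥0∞) ^ r with hlam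
  set c : ℝ≥0∞ := ENNReal.ofReal (Real.exp (-(((d - 1 : ℕ) : ℝ≥0) ^ r * δ₁ : ℝ≥0) / 2)) with hc
  have hq : ((d - 1 : ℕ) : ℝ≥0∞) ≠ 0 := by
    simp only [ne_eq, Nat.cast_eq_zero]; omega
  have hlam1 : ∀ prev cur w, lam * endProb G r prev cur w ≤ 1 := by
    intro prev cur w
    calc lam * endProb G r prev cur w ≤ lam * (((d - 1 : ℕ) : ℝ≥0∞)⁻¹) ^ r := by
          gcongr; exact endProb_le hd hG hr prev cur w
      _ = 1 := by
          rw [hlam, ← mul_pow, ENNReal.mul_inv_cancel hq (by simp), one_pow]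
  -- Only nodes that have entered the level since `x₀` count, so every product starts at `1`; the
  -- older ones are covered by `δ₀`.
  set φ : Option V × V → V → ℕ → ℝ≥0∞ := fun e w m =>
    1 + if κ + 1 ≤ m ∧ x₀ w ≤ κ then lam * endProb G r e.1 e.2 w else 0 with hφ
  set Φ : (V → ℕ) → ℝ≥0∞ := fun x => ∑ e, c * ∏ w, φ e w (x w) with hΦ
  have hΦ0 : Φ x₀ = ((Fintype.card V + 1) * Fintype.card V : ℕ) * c := by
    have : ∀ e, ∏ w, φ e w (x₀ w) = 1 := by
      intro e
      refine Finset.prod_eq_one fun w _ => ?_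
      simp only [hφ]
      rw [if_neg (by omega), add_zero]
    simp only [hΦ, this, mul_one, Finset.sum_const, Finset.card_univ, Fintype.card_prod,
      Fintype.card_option, nsmul_eq_mul]
  rw [← hΦ0]
  refine prob_loadsFrom_le_of_drift hB₂ ?_ ?_ t x₀
  · intro x hx hx2
    rw [not_not] at hx
    simp only [hΦ]
    rw [PMF.expect_finset_sum, Finset.mul_sum]
    refine Finset.sum_le_sum fun e _ => ?_
    rw [PMF.expect_mul_left, mul_left_comm]
    gcongr
    refine expect_allocateBall_prod_le
      (g := fun v => if κ ≤ x v then lam * endProb G r e.1 e.2 v else 0) ?_ ?_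
    · intro v
      simp only [hφ]
      by_cases hv : κ ≤ x v
      · rw [if_pos hv]
        refine le_trans ?_ (le_mul_of_one_le_right' le_self_add)
        gcongr
        split_ifs
        · exact le_rfl
        · exact zero_le
      · rw [if_neg hv, if_neg (by omega)]
        simp
    · calc ∑ v, placement G l r x v * (if κ ≤ x v then lam * endProb G r e.1 e.2 v else 0)
          ≤ ∑ v, (Fintype.card V : ℝ≥0∞)⁻¹ * ρ * lam * endProb G r e.1 e.2 v := by
            refine Finset.sum_le_sum fun v _ => ?_
            split_ifs with hv
            · rw [mul_assoc _ lam]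
              gcongr
              exact hrate x hx hx2 v hv
            · simp
        _ = (Fintype.card V : ℝ≥0∞)⁻¹ * ρ * lam := by
            rw [← Finset.mul_sum, sum_endProb hd hG, mul_one]
  · intro x hx
    unfold SparseAbove at hx
    push Not at hx
    obtain ⟨prev, cur, hx⟩ := hx
    refine le_trans ?_ (Finset.single_le_sum (f := fun e => c * ∏ w, φ e w (x w))
      (fun _ _ => zero_le) (Finset.mem_univ (prev, cur)))
    have hsplit : ∑ w, endProb G r prev cur w * (if κ + 1 ≤ x w then 1 else 0) ≤
        δ₀ + ∑ w, (if κ + 1 ≤ x w ∧ x₀ w ≤ κ then endProb G r prev cur w else 0) := by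
      refine le_trans ?_ (add_le_add_left (h₀ prev cur) _)
      rw [← Finset.sum_add_distrib]
      refine Finset.sum_le_sum fun w _ => ?_
      by_cases h1 : κ + 1 ≤ x w
      · by_cases h2 : x₀ w ≤ κ
        · simp [h1, h2]
        · rw [if_pos h1, if_pos (by omega)]; exact le_self_add
      · simp [h1]
    have hδ : (δ₁ : ℝ≥0∞) ≤
        ∑ w, (if κ + 1 ≤ x w ∧ x₀ w ≤ κ then endProb G r prev cur w else 0) :=
      (ENNReal.add_le_add_iff_left ENNReal.coe_ne_top).mp (hx.le.trans hsplit)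
    have hz := ENNReal.exp_half_le_prod Finset.univ
      (z := fun w => if κ + 1 ≤ x w ∧ x₀ w ≤ κ then lam * endProb G r prev cur w else 0)
      (c := ((d - 1 : ℕ) : ℝ≥0) ^ r * δ₁)
      (by intro w _; split_ifs
          · exact hlam1 prev cur w
          · exact zero_le)
      (by
        rw [ENNReal.coe_mul, ENNReal.coe_pow, ENNReal.coe_natCast]
        refine (mul_le_mul_right hδ lam).trans (le_of_eq ?_)
        rw [Finset.mul_sum]
        simp only [mul_ite, mul_zero])
    calc (1 : ℝ≥0∞) = c * ENNReal.ofReal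
          (Real.exp ((((d - 1 : ℕ) : ℝ≥0) ^ r * δ₁ : ℝ≥0) / 2)) := by
          rw [hc, ← ENNReal.ofReal_mul (Real.exp_pos _).le, ← Real.exp_add]
          rw [neg_div, neg_add_cancel, Real.exp_zero, ENNReal.ofReal_one]
      _ ≤ _ := by
          gcongr

end Sparse

/-! ### Induction over batches and levels -/

section Levels

variable {V : Type*} [Fintype V] [Nonempty V] {G : SimpleGraph V} [DecidableRel G.Adj] {d : ℕ}

omit [DecidableRel G.Adj] in
theorem not_sparseAbove_absorbing {l r r' k : ℕ} {δ : ℝ≥0∞} (x : V → ℕ)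
    (hx : ¬ SparseAbove G r k δ x) (y : V → ℕ) (hy : y ∈ (allocateBall G l r' x).support) :
    ¬ SparseAbove G r k δ y :=
  fun h => hx (h.anti (le_of_mem_support_allocateBall hy))

/-- The bound on the probability that a batch of `q` balls, placed on nodes of a given level at
rate at most `ρ / n`, raises the density of the next level by more than `δ`. -/
noncomputable def batchError (n d r q : ℕ) (ρ : ℝ≥0∞) (δ : ℝ≥0) : ℝ≥0∞ :=
  (1 + (n : ℝ≥0∞)⁻¹ * ρ * ((d - 1 : ℕ) : ℝ≥0∞) ^ r) ^ q *
    (((n + 1) * n : ℕ) * ENNReal.ofReal (Real.exp (-(((d - 1 : ℕ) : ℝ≥0) ^ r * δ : ℝ≥0) / 2)))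

theorem prob_not_sparseAbove_batch_le (hd : 3 ≤ d) (hG : G.IsRegularOfDegree d) {l r : ℕ}
    (hr : 0 < r) (h2r : 2 * r < G.girth) (hl : 9 ≤ l) (hg : l * r < G.girth) {k q t : ℕ}
    (ht : t ≤ q) {δ η : ℝ≥0} (hδ : δ ≤ 512⁻¹) {x₀ : V → ℕ} (h₀ : SparseAbove G r (k + 1) δ x₀) :
    (loadsFrom G l r t x₀).prob (fun x => ¬ SparseAbove G r (k + 2) (δ + η) x) ≤
      batchError (Fintype.card V) d r q 6 512⁻¹ +
        batchError (Fintype.card V) d r q (4 ^ l)⁻¹ η := by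
  have hsum : (δ : ℝ≥0∞) + ((512⁻¹ : ℝ≥0) : ℝ≥0∞) ≤ 256⁻¹ := by
    have : δ + 512⁻¹ ≤ (256⁻¹ : ℝ≥0) := by
      refine (add_le_add_left hδ _).trans (le_of_eq ?_)
      rw [← NNReal.coe_inj]; push_cast; norm_num
    have h := ENNReal.coe_le_coe.mpr this
    rwa [ENNReal.coe_add, ENNReal.coe_inv (r := 256) (by norm_num)] at h
  -- Bootstrapping on level `k + 1`: the rate `6 / n` is valid as long as this level is sparse,
  -- which is the very property whose first failure is being bounded.
  have h1 := prob_not_sparseAbove_le hd hG (l := l) h2r (B₂ := fun _ => False)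
    (fun _ h => h.elim) (ρ := 6) (δ₁ := 512⁻¹) h₀
    (fun x hx _ v hv => placement_le_six hd hG hr hl hg (hx.mono le_rfl hsum) hv) t
  -- Level `k + 2` lies inside level `k + 1`, so its density also starts at most at `δ`; its rate is
  -- `4⁻ˡ / n` unless level `k + 1` stops being sparse.
  have h2 := prob_not_sparseAbove_le hd hG (l := l) h2r
    (B₂ := fun x => ¬ SparseAbove G r (k + 1) 256⁻¹ x)
    not_sparseAbove_absorbing (ρ := (4 ^ l)⁻¹) (δ₁ := η)
    (h₀.mono (Nat.le_succ _) le_rfl) (κ := k + 1)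
    (fun x _ hx v hv => placement_le_inv_four_pow hd hG hr hl hg (not_not.mp hx) hv) t
  have hF : (loadsFrom G l r t x₀).prob (fun _ => False) = 0 := by
    simp [PMF.prob, PMF.expect]
  rw [hF, add_zero] at h1
  have h3 : (loadsFrom G l r t x₀).prob (fun x => ¬ SparseAbove G r (k + 1) 256⁻¹ x) ≤
      (loadsFrom G l r t x₀).prob
        (fun x => ¬ SparseAbove G r (k + 1) (δ + ((512⁻¹ : ℝ≥0) : ℝ≥0∞)) x) :=
    PMF.prob_mono_support _ fun x _ hx h => hx (h.mono le_rfl hsum)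
  rw [add_comm (batchError _ _ _ _ 6 _)]
  refine h2.trans (add_le_add ?_ ((h3.trans h1).trans ?_))
  · unfold batchError
    gcongr
    exact le_self_add
  · unfold batchError
    gcongr
    exact le_self_add

/-- Each batch moves up one level and adds only `η` to the density: the growth of the old level
during the batch is discarded with that level. Initially level `1` is empty. -/
theorem prob_not_sparseAbove_batches_le (hd : 3 ≤ d) (hG : G.IsRegularOfDegree d) {l r : ℕ}
    (hr : 0 < r) (h2r : 2 * r < G.girth) (hl : 9 ≤ l) (hg : l * r < G.girth) {M q : ℕ}
    {η : ℝ≥0} (hη : M * η ≤ 512⁻¹) {i : ℕ} (hi : i ≤ M) {t : ℕ} (ht : t ≤ i * q) :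
    (loads G l r t).prob (fun x => ¬ SparseAbove G r (i + 1) ((i * η : ℝ≥0) : ℝ≥0∞) x) ≤
      i * (batchError (Fintype.card V) d r q 6 512⁻¹ +
        batchError (Fintype.card V) d r q (4 ^ l)⁻¹ η) := by
  classical
  induction i generalizing t with
  | zero =>
    obtain rfl : t = 0 := by omega
    simp [loads, PMF.prob, PMF.expect_pure, SparseAbove]
  | succ i ih =>
    obtain ⟨s, t', hs, ht', rfl⟩ : ∃ s t', s ≤ i * q ∧ t' ≤ q ∧ t = s + t' := by
      rw [add_mul, one_mul] at ht
      exact ⟨min t (i * q), t - min t (i * q), by omega, by omega, by omega⟩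
    rw [loads_add, PMF.prob_bind]
    set E := batchError (Fintype.card V) d r q 6 512⁻¹ +
        batchError (Fintype.card V) d r q (4 ^ l)⁻¹ η with hE
    calc (loads G l r s).expect (fun x => (loadsFrom G l r t' x).prob
            (fun x => ¬ SparseAbove G r (i + 1 + 1) (((i + 1 : ℕ) * η : ℝ≥0) : ℝ≥0∞) x))
        ≤ (loads G l r s).expect (fun x =>
            (if ¬ SparseAbove G r (i + 1) ((i * η : ℝ≥0) : ℝ≥0∞) x then 1 else 0) + E) := by
          refine PMF.expect_mono _ fun x => ?_
          split_ifs with hx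
          · rw [zero_add]
            have hiη : i * η ≤ 512⁻¹ := by
              refine le_trans ?_ hη
              gcongr
              omega
            have := prob_not_sparseAbove_batch_le hd hG hr h2r hl hg ht' (η := η) hiη hx
            rwa [← ENNReal.coe_add, show (i : ℝ≥0) * η + η = ((i + 1 : ℕ) : ℝ≥0) * η by
              push_cast; ring] at this
          · exact (PMF.prob_le_one _ _).trans le_self_add
      _ ≤ i * E + E := by
          rw [PMF.expect_add, PMF.expect_const]
          gcongr
          refine le_of_eq_of_le ?_ (ih (by omega) hs)
          unfold PMF.prob
          congr!
      _ = ((i + 1 : ℕ) : ℝ≥0∞) * E := by push_cast; ring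

end Levels

/-! ### Walks all of whose choices are heavily loaded -/

theorem PMF.expect_comm {α β : Type*} (p : PMF α) (q : PMF β) (f : α → β → ℝ≥0∞) :
    (p.expect fun a => q.expect fun b => f a b) = q.expect fun b => p.expect fun a => f a b := by
  simp only [PMF.expect, ← ENNReal.tsum_mul_left]
  rw [ENNReal.tsum_comm]
  exact tsum_congr fun b => tsum_congr fun a => by ring

section Blocked

variable {V : Type*} [Fintype V] {G : SimpleGraph V}

theorem card_potentialChoices_le (l r : ℕ) (p : List V) :
    (potentialChoices l r p).card ≤ l + 1 := by
  classical
  have h : (potentialChoices l r p).image some ⊆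
      (Finset.range (l + 1)).image fun j => p[j * r]? := by
    intro o ho
    obtain ⟨v, hv, rfl⟩ := Finset.mem_image.mp ho
    obtain ⟨j, hj, hjv⟩ := mem_potentialChoices.mp hv
    exact Finset.mem_image.mpr ⟨j, by simpa [Nat.lt_succ_iff] using hj, hjv⟩
  have h1 := Finset.card_le_card h
  rw [Finset.card_image_of_injective _ (Option.some_injective V)] at h1
  exact h1.trans (Finset.card_image_le.trans (by simp))

theorem le_card_potentialChoices {l r : ℕ} (hr : 0 < r) {p : List V} (hp : p.Nodup)
    (hl : p.length = l * r + 1) : l + 1 ≤ (potentialChoices l r p).card := by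
  classical
  have h : (Finset.range (l + 1)).image (fun j => p[j * r]?) ⊆
      (potentialChoices l r p).image some := by
    intro o ho
    obtain ⟨j, hj, rfl⟩ := Finset.mem_image.mp ho
    have hj' : j ≤ l := by simpa [Nat.lt_succ_iff] using hj
    have hjr : j * r ≤ l * r := Nat.mul_le_mul_right _ hj'
    have hw : p[j * r]? = some (p[j * r]'(by omega)) := List.getElem?_eq_getElem (by omega)
    exact Finset.mem_image.mpr ⟨_, mem_potentialChoices.mpr ⟨j, hj', hw⟩, hw.symm⟩
  have h1 := Finset.card_le_card h
  rw [Finset.card_image_of_injective _ (Option.some_injective V), Finset.card_image_of_injOn,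
    Finset.card_range] at h1
  · exact h1
  · intro i hi j hj hij
    have hi' : i ≤ l := by simpa [Nat.lt_succ_iff] using hi
    have hj' : j ≤ l := by simpa [Nat.lt_succ_iff] using hj
    have hir : i * r ≤ l * r := Nat.mul_le_mul_right _ hi'
    have hjr : j * r ≤ l * r := Nat.mul_le_mul_right _ hj'
    simp only at hij
    rw [List.getElem?_eq_getElem (by omega), List.getElem?_eq_getElem (by omega),
      Option.some.injEq] at hij
    exact Nat.eq_of_mul_eq_mul_right hr ((hp.getElem_inj_iff).mp hij)

/-- Some walk has only potential choices of load at least `b`. -/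
def Blocked (G : SimpleGraph V) (l r b : ℕ) (x : V → ℕ) : Prop :=
  ∃ u, ∃ p ∈ (nbWalk G (l * r) u).support, ∀ v ∈ potentialChoices l r p, b ≤ x v

theorem Blocked.mono {l r b : ℕ} {x y : V → ℕ} (h : Blocked G l r b x) (hxy : x ≤ y) :
    Blocked G l r b y := by
  obtain ⟨u, p, hp, h⟩ := h
  exact ⟨u, p, hp, fun v hv => (h v hv).trans (hxy v)⟩

variable [Nonempty V]

/-- A ball that lifts a node above `b` found all its choices at load at least `b`, and loads never
decrease. -/
theorem maxLoad_le_or_blocked (l r b t : ℕ) {x : V → ℕ} (hx : x ∈ (loads G l r t).support) :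
    maxLoad x ≤ b ∨ Blocked G l r b x := by
  classical
  induction t generalizing x with
  | zero =>
    simp only [loads, PMF.mem_support_pure_iff] at hx
    left
    simp [hx, maxLoad]
  | succ t ih =>
    rw [loads, PMF.mem_support_bind_iff] at hx
    obtain ⟨y, hy, hx⟩ := hx
    have hyx := le_of_mem_support_allocateBall hx
    rcases ih hy with h | h
    swap
    · exact Or.inr (h.mono hyx)
    rw [allocateBall_eq_map, PMF.mem_support_map_iff] at hx
    obtain ⟨v, hv, rfl⟩ := hx
    simp only [placement, PMF.mem_support_bind_iff] at hv
    obtain ⟨u, -, p, hp, hv⟩ := hv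
    rw [uniformOr_support (leastLoaded_nonempty (potentialChoices_nonempty hp)),
      Finset.mem_coe, mem_leastLoaded] at hv
    by_cases hb : b ≤ y v
    · exact Or.inr ⟨u, p, hp, fun w hw => (hb.trans (hv.2 w hw)).trans (hyx w)⟩
    · left
      refine Finset.sup_le fun w _ => ?_
      by_cases hw : w = v
      · subst hw; simp; omega
      · rw [Function.update_of_ne hw]
        exact (Finset.le_sup (f := y) (Finset.mem_univ w)).trans h

variable [DecidableRel G.Adj] {d : ℕ}

/-- The potential of a walk is the product of `(4 ^ l) ^ (load - (k + 1))` over its choices. The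
base cancels the rate `4⁻ˡ / n`, so each of the at most `l + 1` choices contributes only `1 / n` to
the drift. The expectation over walks, rescaled by the inverse of the least path probability,
replaces the union bound over walks. -/
theorem prob_blocked_le (hd : 3 ≤ d) (hG : G.IsRegularOfDegree d) {l r : ℕ} (hr : 0 < r)
    (hl : 9 ≤ l) (hg : l * r < G.girth) (k j t : ℕ) :
    (loads G l r t).prob (Blocked G l r (k + 1 + j)) ≤
      (1 + (Fintype.card V : ℝ≥0∞)⁻¹ * (l + 1)) ^ t * (Fintype.card V *
        (3 / 2 * ((d - 1 : ℕ) : ℝ≥0∞) ^ (l * r) * ((4 ^ l) ^ (j * (l + 1)))⁻¹)) +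
      (loads G l r t).prob (fun x => ¬ SparseAbove G r (k + 1) 256⁻¹ x) := by
  classical
  set y : ℝ≥0∞ := 4 ^ l with hy
  have hy1 : 1 ≤ y := one_le_pow₀ (by norm_num)
  have hy0 : y ≠ 0 := (zero_lt_one.trans_le hy1).ne'
  have hyt : y ≠ ∞ := by simp [hy]
  set C : ℝ≥0∞ := 3 / 2 * ((d - 1 : ℕ) : ℝ≥0∞) ^ (l * r) * (y ^ (j * (l + 1)))⁻¹ with hC
  set φ : List V → V → ℕ → ℝ≥0∞ := fun p w m =>
    if w ∈ potentialChoices l r p then y ^ (m - (k + 1)) else 1 with hφ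
  set Φ : (V → ℕ) → ℝ≥0∞ := fun x =>
    ∑ u, (nbWalk G (l * r) u).expect fun p => C * ∏ w, φ p w (x w) with hΦ
  have hloads : loads G l r t = loadsFrom G l r t fun _ => 0 := by
    have := loads_add (G := G) l r 0 t
    rwa [zero_add, loads, PMF.pure_bind] at this
  have hΦ0 : Φ (fun _ => 0) = Fintype.card V * C := by
    simp [hΦ, hφ, PMF.expect_const]
  rw [hloads, ← hΦ0]
  refine prob_loadsFrom_le_of_drift not_sparseAbove_absorbing ?_ ?_ t _
  · intro x _ hx
    rw [not_not] at hx
    simp only [hΦ]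
    rw [PMF.expect_finset_sum, Finset.mul_sum]
    refine Finset.sum_le_sum fun u _ => ?_
    rw [PMF.expect_comm, ← PMF.expect_mul_left]
    refine PMF.expect_mono _ fun p => ?_
    rw [PMF.expect_mul_left, mul_left_comm]
    gcongr
    refine expect_allocateBall_prod_le
      (g := fun v => if v ∈ potentialChoices l r p ∧ k + 1 ≤ x v then y else 0) ?_ ?_
    · intro v
      simp only [hφ]
      by_cases hv : v ∈ potentialChoices l r p
      · simp only [hv, if_true, true_and]
        by_cases hk : k + 1 ≤ x v
        · rw [if_pos hk, Nat.sub_add_comm hk, pow_succ']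
          gcongr
          exact le_add_self
        -- A step from load `k` to `k + 1` leaves the truncated exponent at `0`, so rates at load
        -- `k` do not matter.
        · rw [if_neg hk, Nat.sub_eq_zero_of_le (by omega), add_zero, one_mul, pow_zero]
          exact one_le_pow₀ hy1
      · simp [hv]
    · calc ∑ v, placement G l r x v *
            (if v ∈ potentialChoices l r p ∧ k + 1 ≤ x v then y else 0)
          ≤ ∑ v, if v ∈ potentialChoices l r p then (Fintype.card V : ℝ≥0∞)⁻¹ else 0 := by
            refine Finset.sum_le_sum fun v _ => ?_
            by_cases hv : v ∈ potentialChoices l r p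
            · by_cases hk : k + 1 ≤ x v
              · rw [if_pos ⟨hv, hk⟩, if_pos hv]
                calc placement G l r x v * y ≤ (Fintype.card V : ℝ≥0∞)⁻¹ * y⁻¹ * y := by
                      gcongr
                      exact placement_le_inv_four_pow hd hG hr hl hg hx hk
                  _ = _ := by rw [mul_assoc, ENNReal.inv_mul_cancel hy0 hyt, mul_one]
              · simp [hk]
            · simp [hv]
        _ = (Fintype.card V : ℝ≥0∞)⁻¹ * (potentialChoices l r p).card := by
            rw [← Finset.sum_filter, Finset.filter_mem_eq_inter, Finset.univ_inter,
              Finset.sum_const, nsmul_eq_mul, mul_comm]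
        _ ≤ _ := by
            gcongr
            exact_mod_cast card_potentialChoices_le l r p
  · rintro x ⟨u, p, hp, hb⟩
    obtain ⟨hpl, hnb, -⟩ := nbWalkAux_support hd hG _ _ _ hp
    have hcard := le_card_potentialChoices hr (hnb.nodup (by omega)) hpl
    have hmass := le_nbWalk_apply hd hG (l * r) hnb hpl (nbWalkAux_getElem?_zero _ _ _ hp)
    have hprod : y ^ (j * (l + 1)) ≤ ∏ w, φ p w (x w) := by
      simp only [hφ]
      rw [Finset.prod_ite_mem, Finset.univ_inter]
      calc y ^ (j * (l + 1)) ≤ y ^ (j * (potentialChoices l r p).card) :=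
            pow_le_pow_right₀ hy1 (Nat.mul_le_mul_left _ hcard)
        _ = ∏ w ∈ potentialChoices l r p, y ^ j := by rw [Finset.prod_const, pow_mul y]
        _ ≤ _ := Finset.prod_le_prod' fun w hw =>
            pow_le_pow_right₀ hy1 (by have := hb w hw; omega)
    have hq : ((d - 1 : ℕ) : ℝ≥0∞) ≠ 0 := by
      simp only [ne_eq, Nat.cast_eq_zero]; omega
    calc (1 : ℝ≥0∞) = (((d - 1 : ℕ) : ℝ≥0∞)⁻¹) ^ (l * r) * ((d - 1 : ℕ) : ℝ≥0∞) ^ (l * r) *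
          ((y ^ (j * (l + 1)))⁻¹ * y ^ (j * (l + 1))) := by
          rw [ENNReal.inv_mul_cancel (pow_ne_zero _ hy0) (ENNReal.pow_ne_top hyt), ← mul_pow,
            ENNReal.inv_mul_cancel hq (by simp), one_pow, one_mul]
      _ ≤ (3 / 2 * nbWalk G (l * r) u p) * ((d - 1 : ℕ) : ℝ≥0∞) ^ (l * r) *
          ((y ^ (j * (l + 1)))⁻¹ * ∏ w, φ p w (x w)) := by gcongr
      _ = nbWalk G (l * r) u p * (C * ∏ w, φ p w (x w)) := by rw [hC]; ring
      _ ≤ (nbWalk G (l * r) u).expect fun p => C * ∏ w, φ p w (x w) :=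
          PMF.mul_le_expect _ _ _
      _ ≤ Φ x := Finset.single_le_sum
          (f := fun u => (nbWalk G (l * r) u).expect fun p => C * ∏ w, φ p w (x w))
          (fun _ _ => zero_le) (Finset.mem_univ u)

end Blocked

/-! ### Real estimates and the combined tail bound -/

theorem ENNReal.one_add_ofReal_pow_le {x : ℝ} (hx : 0 ≤ x) (m : ℕ) :
    (1 + ENNReal.ofReal x) ^ m ≤ ENNReal.ofReal (Real.exp (m * x)) := by
  rw [Real.exp_nat_mul, ENNReal.ofReal_pow (Real.exp_pos _).le, ← ENNReal.ofReal_one,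
    ← ENNReal.ofReal_add zero_le_one hx]
  gcongr
  linarith [Real.add_one_le_exp x]

theorem batchError_le {n d r q : ℕ} (hn : 0 < n) {ρ : ℝ} (hρ : 0 ≤ ρ) (δ : ℝ≥0) :
    batchError n d r q (ENNReal.ofReal ρ) δ ≤ ENNReal.ofReal ((n + 1) * n *
      Real.exp (q * (ρ / n * ((d - 1 : ℕ) : ℝ) ^ r) - ((d - 1 : ℕ) : ℝ) ^ r * δ / 2)) := by
  have hn' : (0 : ℝ) < n := by exact_mod_cast hn
  have h1 : (n : ℝ≥0∞)⁻¹ * ENNReal.ofReal ρ * ((d - 1 : ℕ) : ℝ≥0∞) ^ r =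
      ENNReal.ofReal (ρ / n * ((d - 1 : ℕ) : ℝ) ^ r) := by
    rw [ENNReal.ofReal_mul (by positivity), ENNReal.ofReal_div_of_pos hn', ENNReal.ofReal_natCast,
      ENNReal.ofReal_pow (by positivity), ENNReal.ofReal_natCast, div_eq_mul_inv,
      mul_comm (n : ℝ≥0∞)⁻¹]
  have h2 : (((n + 1) * n : ℕ) : ℝ≥0∞) = ENNReal.ofReal ((n + 1) * n) := by
    rw [← ENNReal.ofReal_natCast]; push_cast; rfl
  rw [batchError, h1, h2]
  refine (mul_le_mul' (ENNReal.one_add_ofReal_pow_le (by positivity) q) le_rfl).trans (le_of_eq ?_)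
  rw [← ENNReal.ofReal_mul (by positivity), ← ENNReal.ofReal_mul (by positivity)]
  congr 1
  rw [sub_eq_add_neg, Real.exp_add]
  rw [NNReal.coe_mul, NNReal.coe_pow, NNReal.coe_natCast, neg_div]
  ring

/-- The number of batches. -/
def numBatches : ℕ := 24576

section Combine

variable {V : Type*} [Fintype V] [Nonempty V] {G : SimpleGraph V} [DecidableRel G.Adj] {d : ℕ}

/-- The end probabilities of `m` steps are at most `(d - 1)⁻ᵐ` each and sum to `1`. -/
theorem pow_le_card_of_lt_girth (hd : 3 ≤ d) (hG : G.IsRegularOfDegree d) {m : ℕ}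
    (hm : 2 * m < G.girth) : (d - 1) ^ m ≤ Fintype.card V := by
  obtain ⟨u⟩ := ‹Nonempty V›
  have h := sum_endProb hd hG m none u
  have h1 : (1 : ℝ≥0∞) ≤ Fintype.card V * (((d - 1 : ℕ) : ℝ≥0∞)⁻¹) ^ m := by
    rw [← h]
    refine (Finset.sum_le_sum fun w _ => endProb_le hd hG hm none u w).trans ?_
    simp
  have hq : ((d - 1 : ℕ) : ℝ≥0∞) ≠ 0 := by
    simp only [ne_eq, Nat.cast_eq_zero]; omega
  rw [← ENNReal.inv_pow, ← div_eq_mul_inv, ENNReal.le_div_iff_mul_le (by simp)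
    (by simp), one_mul] at h1
  exact_mod_cast h1

theorem prob_not_sparseAbove_numBatches_le (hd : 3 ≤ d) (hG : G.IsRegularOfDegree d) {l r : ℕ}
    (hr : 0 < r) (h2r : 2 * r < G.girth) (hl : 9 ≤ l) (hg : l * r < G.girth)
    (hn : numBatches ≤ Fintype.card V) :
    (loads G l r (Fintype.card V)).prob
        (fun x => ¬ SparseAbove G r (numBatches + 1) 256⁻¹ x) ≤
      ENNReal.ofReal (numBatches * (2 * ((Fintype.card V + 1) * Fintype.card V *
        Real.exp (-(((d - 1 : ℕ) : ℝ) ^ r / (2048 * numBatches)))))) := by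
  set n := Fintype.card V with hn_def
  have hM : (0 : ℝ) < numBatches := by norm_num [numBatches]
  have hn0 : 0 < n := Fintype.card_pos
  have hn' : (0 : ℝ) < n := by exact_mod_cast hn0
  set η : ℝ≥0 := (512 * numBatches)⁻¹ with hη
  have hMη : (numBatches : ℝ≥0) * η = 512⁻¹ := by
    rw [hη, ← NNReal.coe_inj]
    push_cast
    field_simp
  set q := n / numBatches + 1 with hq
  have htime : n ≤ numBatches * q := by
    have := Nat.div_add_mod n numBatches
    have := Nat.mod_lt n (show 0 < numBatches by norm_num [numBatches])
    rw [hq, mul_add]; omega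
  have hqn : (q : ℝ) / n ≤ 2 / numBatches := by
    rw [div_le_div_iff₀ hn' hM]
    have h1 : (n / numBatches : ℕ) * numBatches ≤ n := Nat.div_mul_le_self _ _
    have h2 : q * numBatches ≤ 2 * n := by rw [hq, add_mul]; omega
    exact_mod_cast h2
  have hmain := prob_not_sparseAbove_batches_le hd hG hr h2r hl hg hMη.le le_rfl htime
  rw [hMη] at hmain
  have hweak : (loads G l r n).prob (fun x => ¬ SparseAbove G r (numBatches + 1) 256⁻¹ x) ≤
      (loads G l r n).prob
        (fun x => ¬ SparseAbove G r (numBatches + 1) ((512⁻¹ : ℝ≥0) : ℝ≥0∞) x) := by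
    refine PMF.prob_mono_support _ fun x _ hx h => hx (h.mono le_rfl ?_)
    rw [ENNReal.coe_inv (by norm_num)]
    exact ENNReal.inv_le_inv.mpr (by norm_num)
  refine (hweak.trans hmain).trans ?_
  set Λ : ℝ := ((d - 1 : ℕ) : ℝ) ^ r with hΛ
  have hΛ0 : 0 ≤ Λ := by positivity
  have hexp : ∀ ρ : ℝ, 0 ≤ ρ → ∀ δ : ℝ≥0, 1 / (2048 * numBatches) + ρ * (2 / numBatches) ≤ (δ : ℝ) / 2 →
      batchError n d r q (ENNReal.ofReal ρ) δ ≤ ENNReal.ofReal ((n + 1) * n *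
        Real.exp (-(Λ / (2048 * numBatches)))) := by
    intro ρ hρ δ hδ
    refine (batchError_le hn0 hρ δ).trans ?_
    gcongr
    have h1 : (q : ℝ) * (ρ / n * Λ) ≤ ρ * (2 / numBatches) * Λ := by
      calc (q : ℝ) * (ρ / n * Λ) = ρ * (q / n) * Λ := by ring
        _ ≤ _ := by gcongr
    have h2 := mul_le_mul_of_nonneg_left hδ hΛ0
    have h3 : Λ / (2048 * numBatches) = Λ * (1 / (2048 * numBatches)) := by ring
    rw [h3]
    linarith
  -- Here `numBatches = 24576` is chosen: a batch of at most `2 n / numBatches` balls at rate `6 /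
  -- n` contributes `12 / 24576 = 1 / 2048`, half of `512⁻¹ / 2`.
  have h1 := hexp 6 (by norm_num) 512⁻¹ (by push_cast; norm_num [numBatches])
  have h4l : ((4 : ℝ) ^ l)⁻¹ ≤ 4096⁻¹ := by
    refine inv_anti₀ (by norm_num) ?_
    calc (4096 : ℝ) ≤ 4 ^ 9 := by norm_num
      _ ≤ 4 ^ l := pow_le_pow_right₀ (by norm_num) hl
  -- With `4⁻ˡ ≤ 1 / 4096` the drift uses up at most half of `η / 2 = 1 / (1024 * numBatches)`.
  have h2 := hexp ((4 : ℝ) ^ l)⁻¹ (by positivity) η (by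
    have : (η : ℝ) / 2 = 1 / (2048 * numBatches) + 4096⁻¹ * (2 / numBatches) +
        (1 / 2048) / numBatches * 0 := by
      rw [hη]; push_cast; norm_num [numBatches]
    rw [this]
    have := mul_le_mul_of_nonneg_right h4l (show 0 ≤ 2 / (numBatches : ℝ) by positivity)
    linarith)
  rw [show ENNReal.ofReal 6 = 6 by simp] at h1
  rw [ENNReal.ofReal_inv_of_pos (by positivity), ENNReal.ofReal_pow (by norm_num),
    show ENNReal.ofReal 4 = 4 by simp] at h2
  rw [ENNReal.ofReal_mul (by positivity), ENNReal.ofReal_natCast, two_mul,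
    ENNReal.ofReal_add (by positivity) (by positivity)]
  gcongr

theorem prob_lt_maxLoad_le (hd : 3 ≤ d) (hG : G.IsRegularOfDegree d) {l r : ℕ}
    (hr : 0 < r) (h2r : 2 * r < G.girth) (hl : 9 ≤ l) (hg : l * r < G.girth)
    (hn : numBatches ≤ Fintype.card V) {a b : ℝ} (ha : 2 ≤ a)
    (hexp : Real.exp b = Fintype.card V) (hpow : ((d - 1 : ℕ) : ℝ) ^ r ≤ Real.exp (4 * a)) {j : ℕ}
    (hj : 3 * b + 5 * l * a ≤ l ^ 2 * j) :
    (loads G l r (Fintype.card V)).prob (fun x => ¬ maxLoad x ≤ numBatches + 1 + j) ≤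
      ENNReal.ofReal (Real.exp (-(2 * b)) +
        numBatches * (2 * ((Fintype.card V + 1) * Fintype.card V *
        Real.exp (-(((d - 1 : ℕ) : ℝ) ^ r / (2048 * numBatches)))))) := by
  set n := Fintype.card V with hn_def
  have hn0 : 0 < n := Fintype.card_pos
  have hn' : (0 : ℝ) < n := by exact_mod_cast hn0
  have h1 : (loads G l r n).prob (fun x => ¬ maxLoad x ≤ numBatches + 1 + j) ≤
      (loads G l r n).prob (Blocked G l r (numBatches + 1 + j)) :=
    PMF.prob_mono_support _ fun x hx h => (maxLoad_le_or_blocked l r _ n hx).resolve_left h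
  have h2 := prob_blocked_le hd hG hr hl hg numBatches j n
  have h3 := prob_not_sparseAbove_numBatches_le hd hG hr h2r hl hg hn
  rw [ENNReal.ofReal_add (by positivity) (by positivity)]
  refine (h1.trans h2).trans (add_le_add ?_ h3)
  have h4 : (n : ℝ≥0∞)⁻¹ * (l + 1) = ENNReal.ofReal ((l + 1) / n) := by
    rw [ENNReal.ofReal_div_of_pos hn', ENNReal.ofReal_natCast, div_eq_mul_inv, mul_comm,
      ENNReal.ofReal_add (by positivity) zero_le_one, ENNReal.ofReal_natCast, ENNReal.ofReal_one]
  have h5 : (n : ℝ≥0∞) * (3 / 2 * ((d - 1 : ℕ) : ℝ≥0∞) ^ (l * r) *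
      ((4 ^ l) ^ (j * (l + 1)))⁻¹) = ENNReal.ofReal (n * (3 / 2 * ((d - 1 : ℕ) : ℝ) ^ (l * r) *
        ((4 ^ l) ^ (j * (l + 1)))⁻¹)) := by
    rw [ENNReal.ofReal_mul (by positivity), ENNReal.ofReal_mul (by positivity),
      ENNReal.ofReal_mul (by positivity), ENNReal.ofReal_inv_of_pos (by positivity),
      ENNReal.ofReal_pow (by positivity), ENNReal.ofReal_pow (by positivity),
      ENNReal.ofReal_pow (by positivity), ENNReal.ofReal_natCast, ENNReal.ofReal_natCast,
      ENNReal.ofReal_div_of_pos (by norm_num)]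
    simp
  rw [h4, h5]
  refine (mul_le_mul' (ENNReal.one_add_ofReal_pow_le (by positivity) n) le_rfl).trans ?_
  rw [← ENNReal.ofReal_mul (Real.exp_pos _).le]
  refine ENNReal.ofReal_le_ofReal ?_
  have e1 : (n : ℝ) * ((l + 1) / n) = l + 1 := by field_simp
  have e2 : (3 / 2 : ℝ) ≤ Real.exp 1 := by linarith [Real.add_one_le_exp (1 : ℝ)]
  have e3 : ((d - 1 : ℕ) : ℝ) ^ (l * r) ≤ Real.exp (l * (4 * a)) := by
    rw [mul_comm l r, pow_mul, Real.exp_nat_mul]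
    gcongr
  have e4 : (((4 : ℝ) ^ l) ^ (j * (l + 1)))⁻¹ ≤ Real.exp (-(l ^ 2 * j)) := by
    rw [Real.exp_neg]
    refine inv_anti₀ (Real.exp_pos _) ?_
    have h6 : Real.exp 1 ≤ 4 := by linarith [Real.exp_one_lt_d9]
    calc Real.exp ((l : ℝ) ^ 2 * j) = (Real.exp 1) ^ (l ^ 2 * j) := by
          rw [← Real.exp_nat_mul]; push_cast; ring_nf
      _ ≤ 4 ^ (l ^ 2 * j) := by gcongr
      _ ≤ 4 ^ (l * (j * (l + 1))) := by
          refine pow_le_pow_right₀ (by norm_num) ?_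
          nlinarith [Nat.zero_le (l * j)]
      _ = _ := pow_mul _ _ _
  calc Real.exp (n * ((l + 1) / n)) * (n * (3 / 2 * ((d - 1 : ℕ) : ℝ) ^ (l * r) *
        ((4 ^ l) ^ (j * (l + 1)))⁻¹))
      ≤ Real.exp (l + 1) * (Real.exp b * (Real.exp 1 * Real.exp (l * (4 * a)) *
          Real.exp (-(l ^ 2 * j)))) := by
        rw [e1, hexp]
        gcongr
    _ = Real.exp (l + 1 + (b + (1 + l * (4 * a) + -(l ^ 2 * j)))) := by
        simp only [Real.exp_add]
    _ ≤ Real.exp (-(2 * b)) := by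
        -- The exponent needs `l² j ≥ 3 b + 4 l a + l + 2`; the spare `l a` covers `l + 2` because
        -- `a ≥ 2`.
        refine Real.exp_le_exp.mpr ?_
        have hl' : (9 : ℝ) ≤ l := by exact_mod_cast hl
        nlinarith

end Combine

/-! ### Asymptotics and conclusion -/

/-- The size conditions on `n` under which all estimates hold. -/
structure LargeEnough (K w : ℝ) (n : ℕ) : Prop where
  card : numBatches ≤ n
  degree : K ≤ Real.log n
  walk : 9 ≤ w
  loglog : numBatches + 2 ≤ Real.log (Real.log n)
  log : 72 * Real.log (Real.log n) ≤ Real.log n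
  error : Real.exp (-(2 * Real.log n)) + numBatches * (2 * (((n : ℝ) + 1) * n *
    Real.exp (-(Real.log n ^ 2 / (2048 * numBatches))))) ≤ 1 / (n : ℝ) ^ (1 / 2 : ℝ)

theorem eventually_largeEnough (K : ℝ) {ω : ℕ → ℝ} (hω : Tendsto ω atTop atTop) :
    ∀ᶠ n : ℕ in atTop, LargeEnough K (ω n) n := by
  have hlog : Tendsto (fun n : ℕ => Real.log n) atTop atTop :=
    Real.tendsto_log_atTop.comp tendsto_natCast_atTop_atTop
  have hll : Tendsto (fun n : ℕ => Real.log (Real.log n)) atTop atTop :=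
    Real.tendsto_log_atTop.comp hlog
  have hM : (0 : ℝ) < numBatches := by norm_num [numBatches]
  have hlit : ∀ᶠ x : ℝ in atTop, 72 * Real.log x ≤ x := by
    have := (Real.isLittleO_log_id_atTop.def (show (0 : ℝ) < 1 / 72 by norm_num))
    filter_upwards [this, eventually_ge_atTop 1] with x hx h1
    rw [Real.norm_of_nonneg (Real.log_nonneg h1), id, Real.norm_of_nonneg (by linarith)] at hx
    linarith
  filter_upwards [eventually_ge_atTop (numBatches + 2), hlog.eventually_ge_atTop K,
    hω.eventually_ge_atTop 9, hll.eventually_ge_atTop (numBatches + 2), hlog.eventually hlit,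
    hlog.eventually_ge_atTop (2048 * numBatches * (numBatches * 8 + 3))] with n h1 h2 h3 h4 h5 h6
  refine ⟨by omega, h2, h3, h4, h5, ?_⟩
  have hn : (0 : ℝ) < n := by
    have : 0 < n := by omega
    exact_mod_cast this
  have hn2 : (2 : ℝ) ≤ n := by
    have : 2 ≤ n := by omega
    exact_mod_cast this
  set L := Real.log n with hL
  have hexp : Real.exp L = n := Real.exp_log hn
  have hL0 : numBatches * 8 + 3 ≤ L := by
    refine le_trans ?_ h6
    have : (1 : ℝ) ≤ 2048 * numBatches := by norm_num [numBatches]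
    nlinarith
  have e1 : Real.exp (-(L ^ 2 / (2048 * numBatches))) ≤ Real.exp (-((numBatches * 8 + 3) * L)) := by
    refine Real.exp_le_exp.mpr (neg_le_neg ?_)
    rw [le_div_iff₀ (by positivity)]
    nlinarith
  have e2 : (numBatches : ℝ) * 4 ≤ Real.exp (numBatches * 4) := by
    linarith [Real.add_one_le_exp ((numBatches : ℝ) * 4)]
  have e3 : ((n : ℝ) + 1) * n ≤ 2 * Real.exp (2 * L) := by
    rw [two_mul L, Real.exp_add, hexp]; nlinarith
  have e4 : (1 : ℝ) / (n : ℝ) ^ (1 / 2 : ℝ) = Real.exp (-(L / 2)) := by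
    rw [Real.rpow_def_of_pos hn, one_div, ← Real.exp_neg, ← hL]
    ring_nf
  have e5 : (2 : ℝ) ≤ Real.exp 1 := by linarith [Real.add_one_le_exp (1 : ℝ)]
  rw [e4]
  have e6 : numBatches * (2 * (((n : ℝ) + 1) * n *
      Real.exp (-(L ^ 2 / (2048 * numBatches))))) ≤ Real.exp (-L) := by
    calc numBatches * (2 * (((n : ℝ) + 1) * n * Real.exp (-(L ^ 2 / (2048 * numBatches)))))
        ≤ numBatches * (2 * ((2 * Real.exp (2 * L)) * Real.exp (-((numBatches * 8 + 3) * L)))) := by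
          gcongr
      _ = (numBatches * 4) * (Real.exp (2 * L) * Real.exp (-((numBatches * 8 + 3) * L))) := by ring
      _ ≤ Real.exp (numBatches * 4) *
            (Real.exp (2 * L) * Real.exp (-((numBatches * 8 + 3) * L))) := by gcongr
      _ = Real.exp (numBatches * 4 + (2 * L + -((numBatches * 8 + 3) * L))) := by
          simp only [Real.exp_add]
      _ ≤ Real.exp (-L) := by
          refine Real.exp_le_exp.mpr ?_
          nlinarith
  have e7 : Real.exp (-(2 * L)) ≤ Real.exp (-L) := Real.exp_le_exp.mpr (by linarith)
  calc _ ≤ Real.exp (-L) + Real.exp (-L) := add_le_add e7 e6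
    _ = 2 * Real.exp (-L) := by ring
    _ ≤ Real.exp 1 * Real.exp (-L) := by gcongr
    _ = Real.exp (1 + -L) := (Real.exp_add _ _).symm
    _ ≤ _ := Real.exp_le_exp.mpr (by linarith)

/-- The estimates for the stride `r` of a graph of degree `d` on `n` nodes. -/
theorem stride_bounds {n d : ℕ} (hd : 3 ≤ d) (hL : 1 < Real.log n)
    (hdeg : (d : ℝ) ≤ Real.log n ^ 2) :
    0 < stride n d ∧ Real.log n ^ 2 ≤ ((d - 1 : ℕ) : ℝ) ^ stride n d ∧
      ((d - 1 : ℕ) : ℝ) ^ stride n d ≤ Real.exp (4 * Real.log (Real.log n)) ∧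
      (stride n d : ℝ) ≤ 6 * Real.log (Real.log n) ∧
      stride n d * Real.log d ≤ 8 * Real.log (Real.log n) := by
  have hd' : (3 : ℝ) ≤ d := by exact_mod_cast hd
  set L := Real.log n with hLdef
  have hL0 : 0 < L := by linarith
  have hLL : 0 < Real.log L := Real.log_pos hL
  have hcast : ((d - 1 : ℕ) : ℝ) = d - 1 := by rw [Nat.cast_sub (by omega)]; simp
  rw [hcast]
  set b : ℝ := d - 1 with hb
  have hb2 : 2 ≤ b := by linarith
  have hb0 : 0 < b := by linarith
  have hlb : 0 < Real.logb b L := Real.logb_pos (by linarith) hL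
  have hpow : b ^ (2 * Real.logb b L) = L ^ 2 := by
    rw [mul_comm, Real.rpow_mul hb0.le, Real.rpow_logb hb0 (by linarith) hL0]
    norm_num
  set r := stride n d with hr
  have hr1 : 2 * Real.logb b L ≤ r := Nat.le_ceil _
  have hr2 : (r : ℝ) < 2 * Real.logb b L + 1 := Nat.ceil_lt_add_one (by positivity)
  have hupper : b ^ r ≤ Real.exp (4 * Real.log L) := by
    calc b ^ r = b ^ (r : ℝ) := (Real.rpow_natCast _ _).symm
      _ ≤ b ^ (2 * Real.logb b L + 1) :=
          Real.rpow_le_rpow_of_exponent_le (by linarith) hr2.le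
      _ = L ^ 2 * b := by rw [Real.rpow_add hb0, hpow, Real.rpow_one]
      _ ≤ L ^ 2 * L ^ 2 := by gcongr; linarith
      _ = Real.exp (4 * Real.log L) := by
          rw [show 4 * Real.log L = (4 : ℕ) * Real.log L by norm_num, Real.exp_nat_mul,
            Real.exp_log hL0]
          ring
  have hrlog : r * Real.log b ≤ 4 * Real.log L := by
    have := Real.log_le_log (by positivity) hupper
    rwa [Real.log_exp, Real.log_pow] at this
  have hlog2 : Real.log 2 ≤ Real.log b := Real.log_le_log (by norm_num) hb2
  refine ⟨?_, ?_, hupper, ?_, ?_⟩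
  · have : (0 : ℝ) < r := by linarith
    exact_mod_cast this
  · rw [← hpow, ← Real.rpow_natCast]
    exact Real.rpow_le_rpow_of_exponent_le (by linarith) hr1
  · have h2 := Real.log_two_gt_d9
    have : (r : ℝ) * (2 / 3) ≤ 4 * Real.log L :=
      le_trans (by gcongr; linarith) hrlog
    linarith
  -- The stride is defined with base `d - 1`, but `γ'_G` with base `d`; the comparison is `d ≤ (d -
  -- 1) ^ 2`.
  · have h1 : Real.log d ≤ 2 * Real.log b := by
      rw [show 2 * Real.log b = Real.log (b ^ 2) by rw [Real.log_pow]; norm_num]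
      refine Real.log_le_log (by linarith) ?_
      have : (d : ℝ) = b + 1 := by rw [hb]; ring
      rw [this]; nlinarith
    calc r * Real.log d ≤ r * (2 * Real.log b) := by gcongr
      _ = 2 * (r * Real.log b) := by ring
      _ ≤ _ := by linarith

theorem probMaxLoadLE_ge {V : Type*} [Fintype V] [Nonempty V] {G : SimpleGraph V} {d l : ℕ}
    {b ε : ℝ} (hε : 0 ≤ ε)
    (h : (sparseLoads G d l).prob (fun x => ¬ (maxLoad x : ℝ) ≤ b) ≤ ENNReal.ofReal ε) :
    1 - ε ≤ probMaxLoadLE G d l b := by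
  have h1 := (sparseLoads G d l).prob_add_prob_not fun x => (maxLoad x : ℝ) ≤ b
  rw [probMaxLoadLE, ← PMF.prob_eq_toOuterMeasure]
  have hle := (sparseLoads G d l).prob_le_one fun x => (maxLoad x : ℝ) ≤ b
  have hle' := (sparseLoads G d l).prob_le_one fun x => ¬ (maxLoad x : ℝ) ≤ b
  have h2 := congrArg ENNReal.toReal h1
  rw [ENNReal.toReal_add (ne_top_of_le_ne_top ENNReal.one_ne_top hle)
    (ne_top_of_le_ne_top ENNReal.one_ne_top hle'), ENNReal.toReal_one] at h2
  have h3 := ENNReal.toReal_le_of_le_ofReal hε h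
  linarith

/-- With probability at least `1 - n^{-1/2}`, the maximum load is bounded by a constant plus
`3 log n / l² + 5 log log n / l`. -/
theorem probMaxLoadLE_of_largeEnough {K w : ℝ} {n : ℕ} (hn : LargeEnough K w n) {V : Type*}
    [Fintype V] [Nonempty V] {G : SimpleGraph V} [DecidableRel G.Adj] {d l : ℕ}
    (hV : Fintype.card V = n) (hd : 3 ≤ d) (hK : (d : ℝ) ≤ K * Real.log n)
    (hG : G.IsRegularOfDegree d)
    (hg : 10 * (l : ℝ) * Real.log (Real.log n) ^ 2 ≤ (G.girth : ℝ)) (hl : 9 ≤ l) {b : ℝ}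
    (hb : numBatches + 2 + (3 * (Real.log n / l ^ 2) + 5 * (Real.log (Real.log n) / l)) ≤ b) :
    1 - 1 / (n : ℝ) ^ (1 / 2 : ℝ) ≤ probMaxLoadLE G d l b := by
  have hM : (0 : ℝ) < numBatches := by norm_num [numBatches]
  have hl' : (9 : ℝ) ≤ l := by exact_mod_cast hl
  set L := Real.log n with hLdef
  set a := Real.log L with ha
  have ha2 : 2 ≤ a := by linarith [hn.loglog]
  have hL144 : 144 ≤ L := by linarith [hn.log]
  have hn0 : (0 : ℝ) < n := by
    have := hn.card
    have h1 : 0 < n := lt_of_lt_of_le (by norm_num [numBatches]) this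
    exact_mod_cast h1
  have hdeg : (d : ℝ) ≤ L ^ 2 := by nlinarith [hn.degree]
  obtain ⟨hr, hlow, hup, hr6, -⟩ := stride_bounds hd (by linarith) hdeg
  set r := stride n d with hrdef
  have hla : (l : ℝ) * 2 ≤ l * a := by gcongr
  have hgirth : ∀ m : ℝ, m ≤ 6 * l * a → m < G.girth := by
    intro m hm
    refine lt_of_le_of_lt hm (lt_of_lt_of_le ?_ hg)
    nlinarith
  have hlr : l * r < G.girth := by
    have := hgirth ((l : ℝ) * r) (by nlinarith)
    exact_mod_cast this
  have h2r : 2 * r < G.girth := by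
    have := hgirth (2 * (r : ℝ)) (by nlinarith)
    exact_mod_cast this
  set j := ⌈3 * (L / l ^ 2) + 5 * (a / l)⌉₊ with hj
  have hj1 : 3 * (L / l ^ 2) + 5 * (a / l) ≤ j := Nat.le_ceil _
  have hj2 : (j : ℝ) < 3 * (L / l ^ 2) + 5 * (a / l) + 1 := Nat.ceil_lt_add_one (by positivity)
  have hjl : 3 * L + 5 * l * a ≤ l ^ 2 * j := by
    calc 3 * L + 5 * l * a = l ^ 2 * (3 * (L / l ^ 2) + 5 * (a / l)) := by field_simp
      _ ≤ _ := by gcongr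
  subst hV
  have hmain := prob_lt_maxLoad_le hd hG hr h2r hl hlr hn.card ha2 (Real.exp_log hn0) hup hjl
  refine probMaxLoadLE_ge (by positivity) (le_trans (PMF.prob_mono_support _ ?_)
    (hmain.trans (ENNReal.ofReal_le_ofReal (le_trans ?_ hn.error))))
  · intro x _ hx hx'
    refine hx (le_trans ?_ hb)
    have : (maxLoad x : ℝ) ≤ numBatches + 1 + j := by exact_mod_cast hx'
    linarith
  · gcongr

theorem mainTheorem2 (K : ℝ) :
    ∃ C : ℝ, 0 < C ∧ ∃ c : ℝ, 0 < c ∧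
      ∀ ω : ℕ → ℝ, Tendsto ω atTop atTop →
        ∀ᶠ n : ℕ in atTop,
          ∀ (V : Type*) [Fintype V] [Nonempty V] (G : SimpleGraph V) [DecidableRel G.Adj]
            (d l : ℕ),
            Fintype.card V = n → 3 ≤ d → (d : ℝ) ≤ K * Real.log n →
            G.IsRegularOfDegree d →
            10 * (l : ℝ) * Real.log (Real.log n) ^ 2 ≤ (G.girth : ℝ) →
            ((ω n ≤ (l : ℝ) → (l : ℝ) ≤ 4 * gammaG n d →
                1 - 1 / (n : ℝ) ^ c ≤ probMaxLoadLE G d l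
                  (C * (Real.logb d n * Real.log (Real.log n)
                    / ((stride n d : ℝ) * (l : ℝ) ^ 2)))) ∧
              (4 * gammaG n d ≤ (l : ℝ) →
                1 - 1 / (n : ℝ) ^ c ≤ probMaxLoadLE G d l
                  (C * (Real.log (Real.log n) / Real.log ((l : ℝ) / gammaG n d))))) := by
  have hM : (0 : ℝ) < numBatches := by norm_num [numBatches]
  -- The summand `2 * (numBatches + 2)` absorbs the additive constant in part II, where the target
  -- ratio is at least `1 / 2`; `200` covers the remaining multiples of the ratio. In part I that
  -- constant is below `log log n`, which is at most `16` times the ratio.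
  refine ⟨2 * (numBatches + 2) + 200, by positivity, 1 / 2, by norm_num, fun ω hω => ?_⟩
  filter_upwards [eventually_largeEnough K hω] with n hn
  intro V _ _ G _ d l hV hd hK hG hg
  set L := Real.log n with hLdef
  set a := Real.log L with ha
  have haM : (numBatches : ℝ) + 2 ≤ a := hn.loglog
  have ha2 : 2 ≤ a := by linarith
  have hLa : 72 * a ≤ L := hn.log
  have hL144 : 144 ≤ L := by linarith
  have hdeg : (d : ℝ) ≤ L ^ 2 := by nlinarith [hn.degree]
  obtain ⟨hr, -, -, -, hr8⟩ := stride_bounds hd (by linarith) hdeg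
  set r := stride n d with hrdef
  have hr' : (0 : ℝ) < r := by exact_mod_cast hr
  have hd' : (3 : ℝ) ≤ d := by exact_mod_cast hd
  have hlogd : 0 < Real.log d := Real.log_pos (by linarith)
  set γ := gammaG n d with hγ
  have hγsq : γ ^ 2 = Real.logb d n / r := by
    rw [hγ, gammaG, Real.sq_sqrt]
    rw [Real.logb]
    positivity
  have hγL : L ≤ 8 * a * γ ^ 2 := by
    rw [hγsq, Real.logb, div_div, ← mul_div_assoc, le_div_iff₀ (by positivity), mul_comm]
    have := mul_le_mul_of_nonneg_right hr8 (show 0 ≤ L by linarith)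
    linarith
  have hγ0 : 0 ≤ γ := Real.sqrt_nonneg _
  -- In part II there is no lower bound by `ω`; `γ ≥ 3` supplies `l ≥ 12`.
  have hγ3 : 3 ≤ γ := by
    have : 8 * a * 9 ≤ 8 * a * γ ^ 2 := by linarith
    have : 9 ≤ γ ^ 2 := le_of_mul_le_mul_left this (by linarith)
    nlinarith
  refine ⟨fun h1 h2 => ?_, fun h1 => ?_⟩
  · have hl9 : (9 : ℝ) ≤ l := hn.walk.trans h1
    have hl9' : 9 ≤ l := by exact_mod_cast hl9
    refine probMaxLoadLE_of_largeEnough hn hV hd hK hG hg hl9' ?_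
    set R := Real.logb d n * a / (r * (l : ℝ) ^ 2) with hR
    have hR' : R = γ ^ 2 * a / l ^ 2 := by rw [hR, hγsq]; field_simp
    have hR1 : a ≤ 16 * R := by
      rw [hR', ← mul_div_assoc, le_div_iff₀ (by positivity)]
      have : (l : ℝ) ^ 2 ≤ (4 * γ) ^ 2 := by gcongr
      nlinarith
    have hR2 : L / l ^ 2 ≤ 8 * R := by
      rw [hR', ← mul_div_assoc]
      gcongr
      linarith
    have hR3 : a / l ≤ a := div_le_self (by linarith) (by linarith)
    have hMR : 0 ≤ numBatches * R := mul_nonneg hM.le (by linarith)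
    linarith
  · have hl9 : (9 : ℝ) ≤ l := by linarith
    have hl9' : 9 ≤ l := by exact_mod_cast hl9
    refine probMaxLoadLE_of_largeEnough hn hV hd hK hG hg hl9' ?_
    set s := (l : ℝ) / γ with hs
    have hs4 : 4 ≤ s := by rw [hs, le_div_iff₀ (by linarith)]; exact h1
    have hlogs : 0 < Real.log s := Real.log_pos (by linarith)
    have hlogs' : Real.log s ≤ s := (Real.log_le_sub_one_of_pos (by linarith)).trans (by linarith)
    have hsl : s ≤ l := div_le_self (by linarith) (by linarith)
    have h2l : 2 * l < G.girth := by
      have ha4 : 4 ≤ a ^ 2 := by nlinarith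
      have hla : (l : ℝ) * 4 ≤ l * a ^ 2 := by gcongr
      have : (2 * l : ℝ) < G.girth := lt_of_lt_of_le (by linarith) hg
      exact_mod_cast this
    -- The girth condition also bounds `l` from above: `2 ^ l ≤ n`. So `log (l / γ)` is at most `2
    -- log log n`, and the bound of part II cannot fall below a constant.
    have hlL : (l : ℝ) ≤ L ^ 2 := by
      have h3 := pow_le_card_of_lt_girth hd hG h2l
      have h4 : 2 ^ l ≤ n := (Nat.pow_le_pow_left (by omega) l).trans (h3.trans hV.le)
      have h5 : ((2 : ℝ) ^ l) ≤ n := by exact_mod_cast h4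
      have h6 := Real.log_le_log (by positivity) h5
      rw [Real.log_pow] at h6
      have := Real.log_two_gt_d9
      nlinarith
    have hlog2 : Real.log s ≤ 2 * a := by
      refine (Real.log_le_log (by linarith) (hsl.trans hlL)).trans (le_of_eq ?_)
      rw [Real.log_pow]
      push_cast
      rfl
    set R := a / Real.log s with hR
    have hR1 : 1 ≤ 2 * R := by
      rw [hR, ← mul_div_assoc, le_div_iff₀ hlogs]; linarith
    have hlγ : (l : ℝ) = s * γ := by rw [hs]; field_simp
    have hR2 : L / l ^ 2 ≤ 8 * R := by
      calc L / l ^ 2 ≤ 8 * a * γ ^ 2 / l ^ 2 := by gcongr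
        _ = 8 * (a / s ^ 2) := by rw [hlγ]; field_simp
        _ ≤ 8 * R := by
            rw [hR]
            gcongr
            nlinarith
    have hR3 : a / l ≤ R := by
      rw [hR]
      gcongr
      exact hlogs'.trans hsl
    have hMR := mul_le_mul_of_nonneg_left hR1 (show 0 ≤ (numBatches : ℝ) + 2 by linarith)
    linarith
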